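/- Let $d\in\mathbb N$, $d\ge 1$, $a\in(0,\infty)$, $\Omega=(-a,a)^d\subset\mathbb R^d$ with the Euclidean norm $\|\cdot\|$, and let $\mathcal H=\mathbb C\oplus L^2(\Omega,\mathbb C)\oplus L^2_{\rm sym}(\Omega^2,\mathbb C)$, where $L^2_{\rm sym}(\Omega^2,\mathbb C)$ consists of the $f\in L^2(\Omega^2,\mathbb C)$ with $f(x,y)=f(y,x)$ for a.a. $x,y\in\Omega$. **Assumption A.** $w_0\in\mathbb R$, $v_0\in L^2(\Omega,\mathbb C)$, $w_1\in L^\infty(\Omega,\mathbb R)$, $w_2\in C(\Omega^2)\cap L^\infty(\Omega^2,\mathbb R)$ with $w_2(x,y)=w_2(y,x)$ for $x,y\in\Omega$, and $v_1:\Omega^2\to\mathbb C$ is measurable and such that for some $\varepsilon>0$ $$\operatorname*{ess\,sup}_{x\in\Omega}\|v_1(x,\cdot)\|_{L^{2+\varepsilon}(\Omega)}<\infty,\qquad \operatorname*{ess\,sup}_{y\in\Omega}\|v_1(\cdot,y)\|_{L^{2+4/\varepsilon}(\Omega)}<\infty .$$ Under Assumption A let $H$ be the bounded self-adjoint operator in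 $\mathcal H$ $$H=\begin{pmatrix}H_{00}&H_{01}&0\\ H_{01}^*&H_{11}&H_{12}\\ 0&H_{12}^*&H_{22}\end{pmatrix},$$ $$H_{00}f_0=w_0f_0,\quad H_{01}f_1=\int_\Omega v_0(s)f_1(s)\,ds,\quad (H_{11}f_1)(x)=w_1(x)f_1(x),$$ $$(H_{12}f_2)(x)=\int_\Omega v_1(x,s)f_2(x,s)\,ds,\quad (H_{22}f_2)(x,y)=w_2(x,y)f_2(x,y).$$ Let $\sigma_{\rm ess}(H)$ be the set of $z$ for which $H-z$ is not a Fredholm operator, let $E_{\min}=\min\sigma_{\rm ess}(H)$, and for $x\in\Omega$ put $$\Delta(x;E_{\min})=w_1(x)-E_{\min}-\frac12\int_\Omega\frac{|v_1(x,y)|^2}{w_2(x,y)-E_{\min}}\,dy .$$ Fix $\delta\in(0,a)$ and $t_0\in\Omega$, and denote by $B_\delta(t)$ the ball of radius $\delta$ about $t$. For $s\in\mathbb R$ let $\Phi_s(x,y)=\|x\|^s+\|y\|^s$ if $x,y\in B_\delta(0)$ and $\Phi_s(x,y)=1$ otherwise (for $s<0$ with the convention $0^s=0$, so that $\Phi_s(0,y)=\|y\|^s$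 for $0<\|y\|<\delta$). **Assumption B.** There are $\alpha\ge 0$, $\beta\in\mathbb R$ and $C_1,C_2>0$ such that for a.a. $x,y\in\Omega$ $$w_2(x,y)-E_{\min}\ge C_1\Phi_\alpha(x-t_0,y-t_0),\qquad \chi_{B_\delta(t_0)}(y)\,|v_1(x,y)|\le C_2\,\Phi_\beta(0,y-t_0).$$ Let $\alpha^*\in[0,\infty)$ be the infimum of the values of $\alpha$, and $\beta^*\in(-\infty,\infty]$ the supremum of the values of $\beta$, for which this holds. **Assumption C.** There are $\gamma\ge 0$ and $C_3>0$ such that, whenever $\alpha^*<2\beta^*+d$, one has for a.a. $x\in\Omega$ $$\Delta(x;E_{\min})\ge C_3\,\Phi_\gamma(x-t_0,0).$$ Let $\gamma^*\in[0,\infty)$ be the infimum of the values of $\gamma$ for which this holds. **Theorem.** Let Assumptions A, B and C be satisfied and let $\alpha^*+\gamma^*<2\beta^*+d$. Then $H$ has only finitely many eigenvalues, counted with multiplicity, below $E_{\min}=\min\sigma_{\rm ess}(H)$; that is, there are only finitely many eigenvalues $z<E_{\min}$, and each of them has finite multiplicity. -/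

import Mathlib

open MeasureTheory Set
open scoped ENNReal

noncomputable section

namespace TruncatedFock

/-! ### Two general bounded operators on `L²` spaces -/

section General

variable {X : Type*} [MeasurableSpace X]

/-- Multiplication by an essentially bounded real function `w`, as a bounded operator on `L²`. -/
def mulOp (μ : Measure X) (w : X → ℝ) (hw : MemLp w ∞ μ) : Lp ℂ 2 μ →L[ℂ] Lp ℂ 2 μ :=
  (ContinuousLinearMap.mul ℂ ℂ).holderL μ ∞ 2 2 ((hw.ofReal (K := ℂ)).toLp)

theorem mulOp_apply (μ : Measure X) (w : X → ℝ) (hw : MemLp w ∞ μ) (f : Lp ℂ 2 μ) :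
    mulOp μ w hw f =ᵐ[μ] fun x => (w x : ℂ) * f x := by
  have h1 := (ContinuousLinearMap.mul ℂ ℂ).coeFn_holder (r := 2)
    ((hw.ofReal (K := ℂ)).toLp) f
  filter_upwards [h1, (hw.ofReal (K := ℂ)).coeFn_toLp] with x hx hx'
  simp only [mulOp, ContinuousLinearMap.holderL_apply_apply]
  rw [hx, hx']
  simp

/-- The functional `f ↦ ∫ v(s) f(s) ds` on `L²`, for `v ∈ L²`. -/
def pairOp (μ : Measure X) (v : X → ℂ) (hv : MemLp v 2 μ) : Lp ℂ 2 μ →L[ℂ] ℂ :=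
  (ContinuousLinearMap.mul ℂ ℂ).lpPairing μ 2 2 hv.toLp

theorem pairOp_apply (μ : Measure X) (v : X → ℂ) (hv : MemLp v 2 μ) (f : Lp ℂ 2 μ) :
    pairOp μ v hv f = ∫ s, v s * f s ∂μ := by
  rw [pairOp, ContinuousLinearMap.lpPairing_eq_integral]
  refine integral_congr_ae ?_
  filter_upwards [hv.coeFn_toLp] with x hx
  simp [hx]

/-- The measurability and integrability needed to define a partial integral operator. -/
structure PartialKernel (μ : Measure X) (v : X → X → ℂ) : Prop where
  meas : AEStronglyMeasurable (Function.uncurry v) (μ.prod μ)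
  bound : essSup (fun x => eLpNorm (v x) 2 μ) μ < ∞

variable {μ : Measure X} [SFinite μ] {v : X → X → ℂ}

theorem memLp_slice (f : Lp ℂ 2 (μ.prod μ)) :
    ∀ᵐ x ∂μ, MemLp (fun s => f (x, s)) 2 μ := by
  have hm := (Lp.memLp f).1
  have hfin : ∫⁻ x, ∫⁻ s, ‖f (x, s)‖ₑ ^ (2 : ℝ) ∂μ ∂μ < ∞ := by
    rw [← lintegral_prod (fun p : X × X => ‖f p‖ₑ ^ (2 : ℝ)) (hm.enorm.pow_const _)]
    have := lintegral_rpow_enorm_lt_top_of_eLpNorm_lt_top (p := 2) (by simp) (by simp)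
      (Lp.memLp f).2
    simpa using this
  have hlt := ae_lt_top' ((hm.enorm.pow_const (2 : ℝ)).lintegral_prod_right') hfin.ne
  filter_upwards [hlt, hm.prodMk_left] with x hx hx'
  refine ⟨hx', ?_⟩
  rw [eLpNorm_lt_top_iff_lintegral_rpow_enorm_lt_top (by simp) (by simp)]
  simpa using hx

theorem PartialKernel.memLp (hv : PartialKernel μ v) : ∀ᵐ x ∂μ, MemLp (v x) 2 μ := by
  filter_upwards [ae_le_essSup (μ := μ) (f := fun x => eLpNorm (v x) 2 μ), hv.meas.prodMk_left]
    with x hx hx'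
  exact ⟨hx', hx.trans_lt hv.bound⟩

theorem PartialKernel.integrable (hv : PartialKernel μ v) (f : Lp ℂ 2 (μ.prod μ)) :
    ∀ᵐ x ∂μ, Integrable (fun s => v x s * f (x, s)) μ := by
  filter_upwards [hv.memLp, memLp_slice f] with x hx hx'
  exact hx.integrable_mul hx'

theorem PartialKernel.aestronglyMeasurable (hv : PartialKernel μ v) (f : Lp ℂ 2 (μ.prod μ)) :
    AEStronglyMeasurable (fun x => ∫ s, v x s * f (x, s) ∂μ) μ :=
  (hv.meas.mul (Lp.memLp f).1).integral_prod_right'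

theorem eLpNorm_two_rpow {Y : Type*} [MeasurableSpace Y] (ν : Measure Y) (g : Y → ℂ) :
    eLpNorm g 2 ν ^ (2 : ℝ) = ∫⁻ y, ‖g y‖ₑ ^ (2 : ℝ) ∂ν := by
  rw [eLpNorm_eq_lintegral_rpow_enorm_toReal (by simp) (by simp), ← ENNReal.rpow_mul]
  simp

theorem PartialKernel.eLpNorm_le (hv : PartialKernel μ v) (f : Lp ℂ 2 (μ.prod μ)) :
    eLpNorm (fun x => ∫ s, v x s * f (x, s) ∂μ) 2 μ ≤
      essSup (fun x => eLpNorm (v x) 2 μ) μ * eLpNorm f 2 (μ.prod μ) := by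
  set C := essSup (fun x => eLpNorm (v x) 2 μ) μ with hC
  have key : ∀ᵐ x ∂μ, ‖∫ s, v x s * f (x, s) ∂μ‖ₑ ^ (2 : ℝ) ≤
      C ^ (2 : ℝ) * ∫⁻ s, ‖f (x, s)‖ₑ ^ (2 : ℝ) ∂μ := by
    filter_upwards [hv.memLp, memLp_slice f,
      ae_le_essSup (μ := μ) (f := fun x => eLpNorm (v x) 2 μ)] with x hx hx' hx''
    have h1 : ‖∫ s, v x s * f (x, s) ∂μ‖ₑ ≤ eLpNorm (v x) 2 μ *
        eLpNorm (fun s => f (x, s)) 2 μ := by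
      refine (enorm_integral_le_lintegral_enorm _).trans ?_
      rw [← eLpNorm_one_eq_lintegral_enorm]
      have h2 := eLpNorm_smul_le_mul_eLpNorm (p := 2) (q := 2) (r := 1) hx'.1 hx.1
      exact h2
    calc _ ≤ (C * eLpNorm (fun s => f (x, s)) 2 μ) ^ (2 : ℝ) := by
          gcongr
          exact h1.trans (by gcongr)
      _ = _ := by rw [ENNReal.mul_rpow_of_nonneg _ _ (by norm_num), eLpNorm_two_rpow]
  rw [← ENNReal.rpow_le_rpow_iff (z := 2) (by norm_num),
    ENNReal.mul_rpow_of_nonneg _ _ (by norm_num), eLpNorm_two_rpow, eLpNorm_two_rpow]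
  calc _ ≤ ∫⁻ x, C ^ (2 : ℝ) * ∫⁻ s, ‖f (x, s)‖ₑ ^ (2 : ℝ) ∂μ ∂μ := lintegral_mono_ae key
    _ = C ^ (2 : ℝ) * ∫⁻ x, ∫⁻ s, ‖f (x, s)‖ₑ ^ (2 : ℝ) ∂μ ∂μ :=
        lintegral_const_mul' _ _ (ENNReal.rpow_ne_top_of_nonneg (by norm_num) hv.bound.ne)
    _ = _ := by
        rw [← lintegral_prod (fun p : X × X => ‖f p‖ₑ ^ (2 : ℝ))
          ((Lp.memLp f).1.enorm.pow_const _)]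

theorem PartialKernel.memLp_integral (hv : PartialKernel μ v) (f : Lp ℂ 2 (μ.prod μ)) :
    MemLp (fun x => ∫ s, v x s * f (x, s) ∂μ) 2 μ :=
  ⟨hv.aestronglyMeasurable f,
    (hv.eLpNorm_le f).trans_lt (ENNReal.mul_lt_top hv.bound (Lp.memLp f).2)⟩

/-- The partial integral operator `f ↦ (x ↦ ∫ v(x,s) f(x,s) ds)`. -/
def partialIntegralOp (μ : Measure X) [SFinite μ] (v : X → X → ℂ) (hv : PartialKernel μ v) :
    Lp ℂ 2 (μ.prod μ) →L[ℂ] Lp ℂ 2 μ :=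
  LinearMap.mkContinuous
    { toFun := fun f => (hv.memLp_integral f).toLp
      map_add' := by
        intro f g
        rw [← MemLp.toLp_add]
        refine MemLp.toLp_congr _ _ ?_
        filter_upwards [hv.integrable f, hv.integrable g,
          Measure.ae_ae_of_ae_prod (Lp.coeFn_add f g)] with x hf hg hfg
        rw [Pi.add_apply, ← integral_add hf hg]
        refine integral_congr_ae ?_
        filter_upwards [hfg] with s hs
        rw [hs, Pi.add_apply, mul_add]
      map_smul' := by
        intro c f
        rw [RingHom.id_apply, ← MemLp.toLp_const_smul]
        refine MemLp.toLp_congr _ _ ?_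
        filter_upwards [Measure.ae_ae_of_ae_prod (Lp.coeFn_smul c f)] with x hf
        rw [Pi.smul_apply, smul_eq_mul, ← integral_const_mul]
        refine integral_congr_ae ?_
        filter_upwards [hf] with s hs
        simp only [hs, Pi.smul_apply, smul_eq_mul]
        ring }
    (essSup (fun x => eLpNorm (v x) 2 μ) μ).toReal
    (by
      intro f
      simp only [LinearMap.coe_mk, AddHom.coe_mk]
      rw [Lp.norm_toLp, Lp.norm_def, ← ENNReal.toReal_mul]
      exact ENNReal.toReal_mono (ENNReal.mul_ne_top hv.bound.ne (Lp.memLp f).2.ne)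
        (hv.eLpNorm_le f))

theorem partialIntegralOp_apply (hv : PartialKernel μ v) (f : Lp ℂ 2 (μ.prod μ)) :
    partialIntegralOp μ v hv f =ᵐ[μ] fun x => ∫ s, v x s * f (x, s) ∂μ :=
  (hv.memLp_integral f).coeFn_toLp

/-- The symmetric functions `f(x,y) = f(y,x)` (for a.a. `x`, `y`) in `L²(μ ⊗ μ)`. -/
def symL2 (μ : Measure X) [SFinite μ] : Submodule ℂ (Lp ℂ 2 (μ.prod μ)) where
  carrier := {f | ∀ᵐ p ∂μ.prod μ, f p.swap = f p}
  zero_mem' := by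
    have h := Lp.coeFn_zero ℂ 2 (μ.prod μ)
    filter_upwards [h, Measure.measurePreserving_swap.quasiMeasurePreserving.ae h] with p h1 h2
    rw [h1, h2]; rfl
  add_mem' := by
    intro f g hf hg
    have h := Lp.coeFn_add f g
    filter_upwards [hf, hg, h, Measure.measurePreserving_swap.quasiMeasurePreserving.ae h]
      with p h1 h2 h3 h4
    rw [h3, h4, Pi.add_apply, Pi.add_apply, h1, h2]
  smul_mem' := by
    intro c f hf
    have h := Lp.coeFn_smul c f
    filter_upwards [hf, h, Measure.measurePreserving_swap.quasiMeasurePreserving.ae h]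
      with p h1 h3 h4
    rw [h3, h4, Pi.smul_apply, Pi.smul_apply, h1]

theorem isClosed_symL2 (μ : Measure X) [SFinite μ] :
    IsClosed (symL2 μ : Set (Lp ℂ 2 (μ.prod μ))) := by
  have hsw : MeasurePreserving (Prod.swap : X × X → X × X) (μ.prod μ) (μ.prod μ) :=
    Measure.measurePreserving_swap
  have : (symL2 μ : Set (Lp ℂ 2 (μ.prod μ))) =
      {f | Lp.compMeasurePreserving Prod.swap hsw f = f} := by
    ext f
    have h := Lp.coeFn_compMeasurePreserving f hsw
    constructor
    · intro hf
      refine Lp.ext ?_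
      filter_upwards [h, (hf : ∀ᵐ p ∂μ.prod μ, f p.swap = f p)] with p h1 h2
      rw [h1, Function.comp_apply, h2]
    · intro hf
      rw [mem_ofPred_eq] at hf
      rw [hf] at h
      change ∀ᵐ p ∂μ.prod μ, f p.swap = f p
      filter_upwards [h] with p h1
      exact h1.symm
  rw [this]
  exact isClosed_eq (Lp.isometry_compMeasurePreserving hsw).continuous continuous_id

instance (μ : Measure X) [SFinite μ] : CompleteSpace (symL2 μ) :=
  (isClosed_symL2 μ).completeSpace_coe

/-- Multiplication by a symmetric essentially bounded real function on the symmetric subspace. -/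
def symMulOp (μ : Measure X) [SFinite μ] (w : X → X → ℝ)
    (hw : MemLp (Function.uncurry w) ∞ (μ.prod μ)) (hs : ∀ᵐ p ∂μ.prod μ, w p.2 p.1 = w p.1 p.2) :
    symL2 μ →L[ℂ] symL2 μ :=
  ((mulOp (μ.prod μ) (Function.uncurry w) hw).comp (symL2 μ).subtypeL).codRestrict (symL2 μ) <| by
    intro f
    have h := mulOp_apply (μ.prod μ) (Function.uncurry w) hw f
    have hf : ∀ᵐ p ∂μ.prod μ, (f : Lp ℂ 2 (μ.prod μ)) p.swap = (f : Lp ℂ 2 (μ.prod μ)) p := f.2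
    change ∀ᵐ p ∂μ.prod μ, _ = _
    filter_upwards [h, hs, hf, Measure.measurePreserving_swap.quasiMeasurePreserving.ae h]
      with p h1 h2 h3 h4
    simp only [ContinuousLinearMap.comp_apply, Submodule.subtypeL_apply]
    rw [h1, h4, h3]
    simp [Function.uncurry, h2]

theorem symMulOp_apply (w : X → X → ℝ)
    (hw : MemLp (Function.uncurry w) ∞ (μ.prod μ)) (hs : ∀ᵐ p ∂μ.prod μ, w p.2 p.1 = w p.1 p.2)
    (f : symL2 μ) : (symMulOp μ w hw hs f : Lp ℂ 2 (μ.prod μ)) =ᵐ[μ.prod μ]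
      fun p => (w p.1 p.2 : ℂ) * (f : Lp ℂ 2 (μ.prod μ)) p :=
  mulOp_apply (μ.prod μ) (Function.uncurry w) hw f

end General

/-! ### The operator matrix -/

/-- The open cube `Ω = (-a, a)^d` in `ℝ^d` (with the Euclidean norm). -/
def cube (d : ℕ) (a : ℝ) : Set (EuclideanSpace ℝ (Fin d)) := {x | ∀ i, x i ∈ Ioo (-a) a}

/-- Lebesgue measure on the cube `Ω`. -/
abbrev cubeMeasure (d : ℕ) (a : ℝ) : Measure (EuclideanSpace ℝ (Fin d)) :=
  volume.restrict (cube d a)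

theorem isOpen_cube (d : ℕ) (a : ℝ) : IsOpen (cube d a) := by
  have : cube d a = ⋂ i, {x : EuclideanSpace ℝ (Fin d) | x i ∈ Ioo (-a) a} := by
    ext x; simp [cube]
  rw [this]
  exact isOpen_iInter_of_finite fun i => isOpen_Ioo.preimage (by fun_prop)

instance (d : ℕ) (a : ℝ) : IsFiniteMeasure (cubeMeasure d a) := by
  refine ⟨?_⟩
  rw [Measure.restrict_apply_univ]
  refine Bornology.IsBounded.measure_lt_top ?_
  have hb : Bornology.IsBounded (Set.pi univ fun _ : Fin d => Ioo (-a) a) :=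
    Bornology.IsBounded.pi fun _ => Metric.isBounded_Ioo _ _
  refine ((PiLp.antilipschitzWith_ofLp 2 fun _ : Fin d => ℝ).isBounded_preimage hb).subset ?_
  intro x hx
  simpa [cube] using hx

/-- The parameter functions of the operator matrix. -/
structure Params (d : ℕ) where
  w₀ : ℝ
  v₀ : EuclideanSpace ℝ (Fin d) → ℂ
  w₁ : EuclideanSpace ℝ (Fin d) → ℝ
  v₁ : EuclideanSpace ℝ (Fin d) → EuclideanSpace ℝ (Fin d) → ℂ
  w₂ : EuclideanSpace ℝ (Fin d) → EuclideanSpace ℝ (Fin d) → ℝ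

variable {d : ℕ} {a : ℝ}

/-- Standing assumptions on the parameter functions on the cube `Ω = (-a, a)^d`. -/
structure AssumptionA (a : ℝ) (P : Params d) : Prop where
  v₀_memLp : MemLp P.v₀ 2 (cubeMeasure d a)
  w₁_memLp : MemLp P.w₁ ∞ (cubeMeasure d a)
  w₂_continuousOn : ContinuousOn (Function.uncurry P.w₂) (cube d a ×ˢ cube d a)
  w₂_memLp : MemLp (Function.uncurry P.w₂) ∞ ((cubeMeasure d a).prod (cubeMeasure d a))
  w₂_symm : ∀ x ∈ cube d a, ∀ y ∈ cube d a, P.w₂ x y = P.w₂ y x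
  v₁_meas : AEStronglyMeasurable (Function.uncurry P.v₁)
    ((cubeMeasure d a).prod (cubeMeasure d a))
  v₁_bound : ∃ ε : ℝ, 0 < ε ∧
    essSup (fun x => eLpNorm (fun y => P.v₁ x y) (ENNReal.ofReal (2 + ε)) (cubeMeasure d a))
      (cubeMeasure d a) < ∞ ∧
    essSup (fun y => eLpNorm (fun x => P.v₁ x y) (ENNReal.ofReal (2 + 4 / ε)) (cubeMeasure d a))
      (cubeMeasure d a) < ∞

theorem AssumptionA.partialKernel {P : Params d} (hA : AssumptionA a P) :
    PartialKernel (cubeMeasure d a) P.v₁ := by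
  refine ⟨hA.v₁_meas, ?_⟩
  obtain ⟨ε, hε, h, -⟩ := hA.v₁_bound
  set μ := cubeMeasure d a
  set q := ENNReal.ofReal (2 + ε)
  have hq : (2 : ℝ≥0∞) ≤ q := by
    have : (2 : ℝ≥0∞) = ENNReal.ofReal 2 := by simp
    rw [this]
    exact ENNReal.ofReal_le_ofReal (by linarith)
  set K : ℝ≥0∞ := μ univ ^ (1 / (2 : ℝ≥0∞).toReal - 1 / q.toReal)
  have hK : K < ∞ := by
    refine ENNReal.rpow_lt_top_of_nonneg ?_ (measure_ne_top _ _)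
    have hq' : q.toReal = 2 + ε := ENNReal.toReal_ofReal (by linarith)
    rw [hq', ENNReal.toReal_ofNat, sub_nonneg]
    exact one_div_le_one_div_of_le (by norm_num) (by linarith)
  refine lt_of_le_of_lt (essSup_le_of_ae_le
    (essSup (fun x => eLpNorm (fun y => P.v₁ x y) q μ) μ * K) ?_) (ENNReal.mul_lt_top h hK)
  filter_upwards [ae_le_essSup (μ := μ) (f := fun x => eLpNorm (fun y => P.v₁ x y) q μ),
    hA.v₁_meas.prodMk_left] with x hx hx'
  refine (eLpNorm_le_eLpNorm_mul_rpow_measure_univ hq hx').trans ?_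
  exact mul_le_mul' hx le_rfl

theorem AssumptionA.w₂_ae_symm {P : Params d} (hA : AssumptionA a P) :
    ∀ᵐ p ∂(cubeMeasure d a).prod (cubeMeasure d a), P.w₂ p.2 p.1 = P.w₂ p.1 p.2 := by
  rw [Measure.prod_restrict]
  filter_upwards [ae_restrict_mem ((isOpen_cube d a).prod (isOpen_cube d a)).measurableSet]
    with p hp
  exact hA.w₂_symm _ hp.2 _ hp.1

/-- The one-particle space `L²(Ω)`. -/
abbrev H1 (d : ℕ) (a : ℝ) : Type := Lp ℂ 2 (cubeMeasure d a)

/-- The two-particle space `L²_sym(Ω²)`. -/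
abbrev H2 (d : ℕ) (a : ℝ) : Type := symL2 (cubeMeasure d a)

/-- The truncated Fock space `ℂ ⊕ L²(Ω) ⊕ L²_sym(Ω²)` (Hilbert space direct sum). -/
abbrev Fock (d : ℕ) (a : ℝ) : Type := WithLp 2 (ℂ × WithLp 2 (H1 d a × H2 d a))

variable {P : Params d}

/-- `f₀ ↦ w₀ f₀`. -/
def H00 (P : Params d) : ℂ →L[ℂ] ℂ := (P.w₀ : ℂ) • ContinuousLinearMap.id ℂ ℂ

/-- `f₁ ↦ ∫ v₀(s) f₁(s) ds`. -/
def H01 (hA : AssumptionA a P) : H1 d a →L[ℂ] ℂ := pairOp (cubeMeasure d a) P.v₀ hA.v₀_memLp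

/-- `(H₁₁ f₁)(x) = w₁(x) f₁(x)`. -/
def H11 (hA : AssumptionA a P) : H1 d a →L[ℂ] H1 d a :=
  mulOp (cubeMeasure d a) P.w₁ hA.w₁_memLp

/-- `(H₁₂ f₂)(x) = ∫ v₁(x,s) f₂(x,s) ds`. -/
def H12 (hA : AssumptionA a P) : H2 d a →L[ℂ] H1 d a :=
  (partialIntegralOp (cubeMeasure d a) P.v₁ hA.partialKernel).comp
    (symL2 (cubeMeasure d a)).subtypeL

/-- `(H₂₂ f₂)(x,y) = w₂(x,y) f₂(x,y)`. -/
def H22 (hA : AssumptionA a P) : H2 d a →L[ℂ] H2 d a :=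
  symMulOp (cubeMeasure d a) P.w₂ hA.w₂_memLp hA.w₂_ae_symm

/-- The operator matrix
`(H₀₀, H₀₁, 0; H₀₁*, H₁₁, H₁₂; 0, H₁₂*, H₂₂)` on the truncated Fock space. -/
def hamiltonian (hA : AssumptionA a P) : Fock d a →L[ℂ] Fock d a :=
  let p₀ : Fock d a →L[ℂ] ℂ := WithLp.fstL 2 ℂ _ _
  let p₁ : Fock d a →L[ℂ] H1 d a := (WithLp.fstL 2 ℂ _ _).comp (WithLp.sndL 2 ℂ _ _)
  let p₂ : Fock d a →L[ℂ] H2 d a := (WithLp.sndL 2 ℂ _ _).comp (WithLp.sndL 2 ℂ _ _)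
  let r₀ := (H00 P).comp p₀ + (H01 hA).comp p₁
  let r₁ := (ContinuousLinearMap.adjoint (H01 hA)).comp p₀ + (H11 hA).comp p₁ + (H12 hA).comp p₂
  let r₂ := (ContinuousLinearMap.adjoint (H12 hA)).comp p₁ + (H22 hA).comp p₂
  ((WithLp.prodContinuousLinearEquiv 2 ℂ ℂ (WithLp 2 (H1 d a × H2 d a))).symm :
      ℂ × WithLp 2 (H1 d a × H2 d a) →L[ℂ] Fock d a).comp
    (r₀.prod (((WithLp.prodContinuousLinearEquiv 2 ℂ (H1 d a) (H2 d a)).symm :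
      H1 d a × H2 d a →L[ℂ] WithLp 2 (H1 d a × H2 d a)).comp (r₁.prod r₂)))

theorem hamiltonian_apply (hA : AssumptionA a P) (f : Fock d a) :
    hamiltonian hA f = WithLp.toLp 2
      ((P.w₀ : ℂ) * f.fst + H01 hA f.snd.fst,
        WithLp.toLp 2
          (ContinuousLinearMap.adjoint (H01 hA) f.fst + H11 hA f.snd.fst + H12 hA f.snd.snd,
            ContinuousLinearMap.adjoint (H12 hA) f.snd.fst + H22 hA f.snd.snd)) :=
  rfl

/-- The essential spectrum of a (self-adjoint) bounded operator `T`: the real `z` for which `T - z`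
is not a Fredholm operator. -/
def essentialSpectrum {E : Type*} [NormedAddCommGroup E] [NormedSpace ℂ E] (T : E →L[ℂ] E) :
    Set ℝ :=
  {z | ¬ (T - (z : ℂ) • ContinuousLinearMap.id ℂ E).IsFredholm}

/-! ### Power bounds near a point `(t₀, t₀)` -/

/-- `Φ_s(x,y) = ‖x‖^s + ‖y‖^s` if `x` and `y` lie in the ball of radius `δ` about `0`, and
`Φ_s(x,y) = 1` otherwise. For negative `s` this uses the convention `0 ^ s = 0`, so that
`Φ_s(0,y) = ‖y‖^s` for `‖y‖ < δ` whenever `s ≠ 0`. -/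
def Phi (δ s : ℝ) (x y : EuclideanSpace ℝ (Fin d)) : ℝ :=
  open scoped Classical in
  if x ∈ Metric.ball 0 δ ∧ y ∈ Metric.ball 0 δ then ‖x‖ ^ s + ‖y‖ ^ s else 1

/-- `Δ(x;z) = w₁(x) - z - ½ ∫_Ω |v₁(x,y)|² / (w₂(x,y) - z) dy`. -/
def Delta (a : ℝ) (P : Params d) (x : EuclideanSpace ℝ (Fin d)) (z : ℝ) : ℝ :=
  P.w₁ x - z - 1 / 2 * ∫ y in cube d a, ‖P.v₁ x y‖ ^ 2 / (P.w₂ x y - z)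

/-- The exponents `α ≥ 0` and `β` satisfy the power bounds
`w₂(x,y) - E ≥ C₁ Φ_α(x - t₀, y - t₀)` and `χ_{B_δ(t₀)}(y) |v₁(x,y)| ≤ C₂ Φ_β(0, y - t₀)`
for a.a. `x, y ∈ Ω`, with some constants `C₁, C₂ > 0`. -/
def BoundsB (a : ℝ) (P : Params d) (E δ : ℝ) (t₀ : EuclideanSpace ℝ (Fin d)) (α β : ℝ) : Prop :=
  0 ≤ α ∧ ∃ C₁ C₂ : ℝ, 0 < C₁ ∧ 0 < C₂ ∧
    ∀ᵐ p ∂(cubeMeasure d a).prod (cubeMeasure d a),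
      C₁ * Phi δ α (p.1 - t₀) (p.2 - t₀) ≤ P.w₂ p.1 p.2 - E ∧
      (Metric.ball t₀ δ).indicator (fun _ => (1 : ℝ)) p.2 * ‖P.v₁ p.1 p.2‖ ≤
        C₂ * Phi δ β 0 (p.2 - t₀)

/-- Some exponents `α`, `β` satisfy the power bounds at the point `t₀ ∈ Ω` with radius
`δ ∈ (0, a)`. -/
def AssumptionB (a : ℝ) (P : Params d) (E δ : ℝ) (t₀ : EuclideanSpace ℝ (Fin d)) : Prop :=
  δ ∈ Ioo 0 a ∧ t₀ ∈ cube d a ∧ ∃ α β : ℝ, BoundsB a P E δ t₀ α β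

/-- `α*`, the infimum of the admissible exponents `α`. -/
def alphaStar (a : ℝ) (P : Params d) (E δ : ℝ) (t₀ : EuclideanSpace ℝ (Fin d)) : EReal :=
  sInf {r | ∃ α β : ℝ, BoundsB a P E δ t₀ α β ∧ r = (α : EReal)}

/-- `β*`, the supremum of the admissible exponents `β`; it may be `+∞`. -/
def betaStar (a : ℝ) (P : Params d) (E δ : ℝ) (t₀ : EuclideanSpace ℝ (Fin d)) : EReal :=
  sSup {r | ∃ α β : ℝ, BoundsB a P E δ t₀ α β ∧ r = (β : EReal)}

/-- The exponent `γ ≥ 0` satisfies, for some `C₃ > 0`, the following: whenever `α* < 2β* + d`,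
`Δ(x;E) ≥ C₃ Φ_γ(x - t₀, 0)` for a.a. `x ∈ Ω`. -/
def BoundC (a : ℝ) (P : Params d) (E δ : ℝ) (t₀ : EuclideanSpace ℝ (Fin d)) (γ : ℝ) : Prop :=
  0 ≤ γ ∧ ∃ C₃ : ℝ, 0 < C₃ ∧
    (alphaStar a P E δ t₀ < 2 * betaStar a P E δ t₀ + (d : EReal) →
      ∀ᵐ x ∂cubeMeasure d a, C₃ * Phi δ γ (x - t₀) 0 ≤ Delta a P x E)

/-- Some exponent `γ` satisfies the power bound on `Δ(·;E)`. -/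
def AssumptionC (a : ℝ) (P : Params d) (E δ : ℝ) (t₀ : EuclideanSpace ℝ (Fin d)) : Prop :=
  ∃ γ : ℝ, BoundC a P E δ t₀ γ

/-- `γ*`, the infimum of the admissible exponents `γ`. -/
def gammaStar (a : ℝ) (P : Params d) (E δ : ℝ) (t₀ : EuclideanSpace ℝ (Fin d)) : EReal :=
  sInf {r | ∃ γ : ℝ, BoundC a P E δ t₀ γ ∧ r = (γ : EReal)}

end TruncatedFock

end

/-! It suffices to bound the dimension of every subspace on which the quadratic form of `H - E`, `E
= Emin`, is negative: eigenvectors of the symmetric `H` for eigenvalues below `E` span such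
subspaces.

Discarding the vacuum component costs at most one dimension. For a state `(0, f, φ)` put `b = w₂ -
E`, which is positive almost everywhere. Since `φ` is symmetric, the coupling term can be
symmetrized, and completing the square in `φ` (`SquareData.form_nonneg`) leaves two terms in `f`.
The diagonal one turns `w₁ - E` into `Δ(·;E)`; the other has the exchange kernel `v₁(x,y)
conj(v₁(y,x)) / b(x,y)`. Hence negativity of the form gives `∫ Δ |f|² < ½ Re ⟨f, exchange f⟩`.

Choose a weight `S` with `S² ≤ Δ`, nonzero almost everywhere, and set `g = S f`. Then `‖g‖² ≤ Re ⟨g,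
K g⟩` with `K` the exchange kernel divided by `2 S(x) S(y)`. If `K` is square-integrable, Bessel's
inequality bounds the dimension of the space of such `g` by `‖K‖²` (`finrank_le_of_kernel`).

Square-integrability of `K` (`memLp_weighted_exchangeKernel`) is where the exponents enter. Near
`(t₀, t₀)`, `|K|²` is at most a constant times the product of `‖x - t₀‖ ^ (2β - α - γ)` and `‖y -
t₀‖ ^ (2β - α - γ)`, which is integrable exactly when `α + γ < 2β + d`. Elsewhere Assumption A
supplies the missing integrability. -/

namespace TruncatedFock

/-! ### Counting eigenvalues through negative subspaces of the form -/

section Abstract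

variable {F : Type*} [NormedAddCommGroup F] [InnerProductSpace ℂ F]

/-- If the form of `T - E` is negative on subspaces of bounded dimension only, then each eigenspace
of `T` below `E` is finite-dimensional. -/
theorem finiteDimensional_eigenspace_of_form {T : F →ₗ[ℂ] F} {E : ℝ} {N : ℕ}
    (h : ∀ V : Submodule ℂ F, FiniteDimensional ℂ V →
      (∀ f ∈ V, f ≠ 0 → (inner ℂ f (T f)).re < E * ‖f‖ ^ 2) → Module.finrank ℂ V ≤ N)
    {z : ℝ} (hz : z < E) : FiniteDimensional ℂ (Module.End.eigenspace T (z : ℂ)) := by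
  -- `finrank` of an infinite-dimensional space is `0`, so the bound is applied to spans of finite
  -- independent families and passed to the cardinal rank.
  refine Module.rank_lt_aleph0_iff.1
    (lt_of_le_of_lt (rank_le (n := N) ?_) Cardinal.natCast_lt_aleph0)
  intro s hs
  let V : Submodule ℂ (Module.End.eigenspace T (z : ℂ)) := Submodule.span ℂ (s : Set _)
  have hV : FiniteDimensional ℂ V := FiniteDimensional.span_finset ℂ s
  have h1 : Module.finrank ℂ V = s.card := finrank_span_finset_eq_card hs
  let V' := V.map (Module.End.eigenspace T (z : ℂ)).subtype
  have h2 : Module.finrank ℂ V' = Module.finrank ℂ V :=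
    (Submodule.equivMapOfInjective _ (Submodule.subtype_injective _) V).finrank_eq.symm
  rw [← h1, ← h2]
  refine h V' inferInstance ?_
  rintro f ⟨g, -, rfl⟩ hf
  have hg : T g = (z : ℂ) • (g : F) := Module.End.mem_eigenspace_iff.1 g.2
  have hpos : 0 < ‖(g : F)‖ ^ 2 := by
    have := norm_pos_iff.2 hf
    simp only [Submodule.subtype_apply] at this
    positivity
  simp only [Submodule.subtype_apply]
  rw [hg, inner_smul_right, inner_self_eq_norm_sq_to_K]
  have h3 : ((z : ℂ) * ((‖(g : F)‖ : ℝ) : ℂ) ^ 2).re = z * ‖(g : F)‖ ^ 2 := by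
    rw [← Complex.ofReal_re (z * ‖(g : F)‖ ^ 2)]
    push_cast
    rfl
  exact h3.trans_lt (mul_lt_mul_of_pos_right hz hpos)

/-- If the form of the symmetric operator `T - E` is negative on subspaces of bounded dimension
only, then `T` has only finitely many eigenvalues below `E`. -/
theorem finite_eigenvalues_of_form {T : F →ₗ[ℂ] F} (hT : T.IsSymmetric) {E : ℝ} {N : ℕ}
    (h : ∀ V : Submodule ℂ F, FiniteDimensional ℂ V →
      (∀ f ∈ V, f ≠ 0 → (inner ℂ f (T f)).re < E * ‖f‖ ^ 2) → Module.finrank ℂ V ≤ N) :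
    {z : ℝ | z < E ∧ Module.End.HasEigenvalue T (z : ℂ)}.Finite := by
  by_contra hinf
  obtain ⟨t, ht, hcard⟩ := Set.Infinite.exists_subset_card_eq hinf (N + 1)
  have hv : ∀ z : t, ∃ u : F, Module.End.HasEigenvector T ((z : ℝ) : ℂ) u :=
    fun z => (ht z.2).2.exists_hasEigenvector
  choose u hu using hv
  have hTu : ∀ z : t, T (u z) = ((z : ℝ) : ℂ) • u z := fun z => (hu z).apply_eq_smul
  have horth : ∀ z w : t, z ≠ w → inner ℂ (u z) (u w) = 0 := by
    intro z w hzw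
    have hne : ((z : ℝ) : ℂ) ≠ ((w : ℝ) : ℂ) :=
      fun he => hzw (Subtype.ext (Complex.ofReal_injective he))
    exact hT.orthogonalFamily_eigenspaces hne ⟨u z, (hu z).1⟩ ⟨u w, (hu w).1⟩
  have hli : LinearIndependent ℂ u :=
    linearIndependent_of_ne_zero_of_inner_eq_zero (fun z => (hu z).2) (fun z w hzw => horth z w hzw)
  have hrank : Module.finrank ℂ (Submodule.span ℂ (range u)) = N + 1 := by
    rw [finrank_span_eq_card hli, Fintype.card_coe, hcard]
  have hfin : FiniteDimensional ℂ (Submodule.span ℂ (range u)) :=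
    FiniteDimensional.span_of_finite ℂ (finite_range u)
  have hle := h (Submodule.span ℂ (range u)) hfin ?_
  · omega
  intro f hf hf0
  obtain ⟨c, rfl⟩ := (Submodule.mem_span_range_iff_exists_fun ℂ).1 hf
  -- The free factors `b` let one computation serve twice: `b = 1` gives the norm, `b z = z` the
  -- form of `T`.
  have key : ∀ b : t → ℂ, inner ℂ (∑ z, c z • u z) (∑ z, (b z * c z) • u z) =
      ∑ z, b z * ((‖c z‖ ^ 2 * ‖u z‖ ^ 2 : ℝ) : ℂ) := by
    intro b
    rw [sum_inner]
    refine Finset.sum_congr rfl fun z _ => ?_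
    rw [inner_sum, Finset.sum_eq_single z]
    · rw [inner_smul_left, inner_smul_right, inner_self_eq_norm_sq_to_K]
      have h1 : starRingEnd ℂ (c z) * c z = (‖c z‖ : ℂ) ^ 2 := RCLike.conj_mul _
      push_cast
      rw [← h1]
      change _ * (_ * (‖u z‖ : ℂ) ^ 2) = _
      ring
    · intro w _ hw
      rw [inner_smul_left, inner_smul_right, horth z w hw.symm]
      simp
    · simp
  have hTf : T (∑ z, c z • u z) = ∑ z : t, (((z : ℝ) : ℂ) * c z) • u z := by
    rw [map_sum]
    refine Finset.sum_congr rfl fun z _ => ?_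
    rw [map_smul, hTu, smul_smul, mul_comm]
  have hn : ‖∑ z, c z • u z‖ ^ 2 = ∑ z, ‖c z‖ ^ 2 * ‖u z‖ ^ 2 := by
    have h1 := key fun _ => 1
    simp only [one_mul] at h1
    rw [inner_self_eq_norm_sq_to_K] at h1
    exact Complex.ofReal_injective (by push_cast at h1 ⊢; exact h1)
  rw [hTf, key, hn, Finset.mul_sum]
  have hre : (∑ z : t, ((z : ℝ) : ℂ) * ((‖c z‖ ^ 2 * ‖u z‖ ^ 2 : ℝ) : ℂ)).re =
      ∑ z : t, (z : ℝ) * (‖c z‖ ^ 2 * ‖u z‖ ^ 2) := by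
    rw [← Complex.ofReal_re (∑ z : t, (z : ℝ) * (‖c z‖ ^ 2 * ‖u z‖ ^ 2))]
    push_cast
    rfl
  rw [hre]
  obtain ⟨z, hz⟩ : ∃ z, c z ≠ 0 := by
    by_contra! hc
    exact hf0 (by simp [hc])
  refine Finset.sum_lt_sum (fun w _ => ?_) ⟨z, Finset.mem_univ _, ?_⟩
  · exact mul_le_mul_of_nonneg_right (ht w.2).1.le (by positivity)
  · refine mul_lt_mul_of_pos_right (ht z.2).1 ?_
    have h1 := norm_pos_iff.2 hz
    have h2 := norm_pos_iff.2 (hu z).2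
    positivity

end Abstract

/-! ### Dimension bound by a Hilbert–Schmidt norm -/

section Bessel

variable {X : Type*} [MeasurableSpace X] {μ : Measure X}

theorem memLp_tensor (f g : Lp ℂ 2 μ) :
    MemLp (fun p : X × X => f p.1 * starRingEnd ℂ (g p.2)) 2 (μ.prod μ) := by
  have hm : AEStronglyMeasurable (fun p : X × X => f p.1 * starRingEnd ℂ (g p.2)) (μ.prod μ) :=
    (Lp.aestronglyMeasurable f).comp_fst.mul
      (RCLike.continuous_conj.comp_aestronglyMeasurable (Lp.aestronglyMeasurable g).comp_snd)
  rw [memLp_two_iff_integrable_sq_norm hm]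
  have h := ((Lp.memLp f).integrable_norm_pow (by norm_num)).mul_prod
    ((Lp.memLp g).integrable_norm_pow (by norm_num))
  refine h.congr (ae_of_all _ fun p => ?_)
  simp [mul_pow]

/-- If a form with square-integrable kernel `K` dominates the squared norm on a subspace, the
dimension of the subspace is at most the squared Hilbert-Schmidt norm. -/
theorem finrank_le_of_kernel [SFinite μ] {K : X × X → ℂ} (hK : MemLp K 2 (μ.prod μ))
    (W : Submodule ℂ (Lp ℂ 2 μ)) [FiniteDimensional ℂ W]
    (hW : ∀ g ∈ W, ‖g‖ ^ 2 ≤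
      (∫ p, starRingEnd ℂ (g p.1) * g p.2 * K p ∂μ.prod μ).re) :
    (Module.finrank ℂ W : ℝ) ≤ ‖hK.toLp‖ ^ 2 := by
  let b := stdOrthonormalBasis ℂ W
  -- The diagonal tensors `b i ⊗ conj (b i)` are orthonormal in `L²(μ ⊗ μ)`, and pairing one with
  -- `K` gives the form at `b i`, of modulus at least `1`. Bessel's inequality then counts them.
  let T : Fin (Module.finrank ℂ W) → Lp ℂ 2 (μ.prod μ) :=
    fun i => (memLp_tensor (b i : Lp ℂ 2 μ) (b i : Lp ℂ 2 μ)).toLp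
  have hb : ∀ i j, inner ℂ (b i : Lp ℂ 2 μ) (b j : Lp ℂ 2 μ) = if i = j then (1 : ℂ) else 0 :=
    fun i j => orthonormal_iff_ite.1 b.orthonormal i j
  have hT : Orthonormal ℂ T := by
    rw [orthonormal_iff_ite]
    intro i j
    have h1 : inner ℂ (T i) (T j) = inner ℂ (b i : Lp ℂ 2 μ) (b j : Lp ℂ 2 μ) *
        inner ℂ (b j : Lp ℂ 2 μ) (b i : Lp ℂ 2 μ) := by
      rw [L2.inner_def, L2.inner_def, L2.inner_def, ← integral_prod_mul]
      refine integral_congr_ae ?_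
      filter_upwards [(memLp_tensor (b i : Lp ℂ 2 μ) (b i : Lp ℂ 2 μ)).coeFn_toLp,
        (memLp_tensor (b j : Lp ℂ 2 μ) (b j : Lp ℂ 2 μ)).coeFn_toLp] with p h1 h2
      simp only [T]
      rw [h1, h2]
      simp only [RCLike.inner_apply, map_mul, RingHomCompTriple.comp_apply, RingHom.id_apply]
      ring
    rw [h1, hb, hb]
    by_cases hij : i = j
    · simp [hij]
    · simp [hij]
  have hone : ∀ i, 1 ≤ ‖inner ℂ (T i) hK.toLp‖ ^ 2 := by
    intro i
    have h1 : inner ℂ (T i) hK.toLp = ∫ p, starRingEnd ℂ ((b i : Lp ℂ 2 μ) p.1) *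
        (b i : Lp ℂ 2 μ) p.2 * K p ∂μ.prod μ := by
      rw [L2.inner_def]
      refine integral_congr_ae ?_
      filter_upwards [(memLp_tensor (b i : Lp ℂ 2 μ) (b i : Lp ℂ 2 μ)).coeFn_toLp,
        hK.coeFn_toLp] with p h1 h2
      simp only [T]
      rw [h1, h2]
      simp only [RCLike.inner_apply, map_mul, Complex.conj_conj]
      ring
    have h2 := hW _ (b i).2
    have h3 : ‖(b i : Lp ℂ 2 μ)‖ = 1 := b.orthonormal.1 i
    rw [h3, ← h1] at h2
    have h4 : 1 ≤ ‖inner ℂ (T i) hK.toLp‖ := by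
      have := (Complex.re_le_norm (inner ℂ (T i) hK.toLp))
      linarith
    nlinarith
  calc (Module.finrank ℂ W : ℝ) = ∑ _i : Fin (Module.finrank ℂ W), (1 : ℝ) := by simp
    _ ≤ ∑ i, ‖inner ℂ (T i) hK.toLp‖ ^ 2 := Finset.sum_le_sum fun i _ => hone i
    _ ≤ _ := hT.sum_inner_products_le _

end Bessel

/-! ### Integrable powers and the choice of exponents -/

theorem integrableOn_norm_sub_rpow {d : ℕ} (hd : 0 < d) {s : ℝ} (hs : -(d : ℝ) < s) (δ : ℝ)
    (t₀ : EuclideanSpace ℝ (Fin d)) :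
    IntegrableOn (fun x => ‖x - t₀‖ ^ s) (Metric.ball t₀ δ) volume := by
  have : Nonempty (Fin d) := ⟨⟨0, hd⟩⟩
  have h0 : IntegrableOn (fun x : EuclideanSpace ℝ (Fin d) => ‖x‖ ^ s) (Metric.ball 0 δ)
      volume := by
    -- Polar coordinates reduce the claim to `y ^ (d - 1 + s)` on `(0, δ)`, integrable because `s >
    -- -d`.
    rw [integrableOn_fun_norm_addHaar volume (f := fun y : ℝ => y ^ s)]
    have h1 : IntegrableOn (fun y : ℝ => y ^ ((d : ℝ) - 1 + s)) (Ioo 0 δ) := by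
      rcases le_or_gt δ 0 with hδ | hδ
      · simp [hδ]
      · exact (intervalIntegral.integrableOn_Ioo_rpow_iff hδ).2 (by linarith)
    refine h1.congr_fun (fun y hy => ?_) measurableSet_Ioo
    simp only [finrank_euclideanSpace, Fintype.card_fin, smul_eq_mul]
    rw [Real.rpow_add hy.1, ← Real.rpow_natCast, Nat.cast_sub (by omega), Nat.cast_one]
  have hpre : (fun x => x - t₀) ⁻¹' Metric.ball (0 : EuclideanSpace ℝ (Fin d)) δ =
      Metric.ball t₀ δ := by
    ext x; simp [dist_eq_norm]
  have hmp := measurePreserving_sub_right (volume : Measure (EuclideanSpace ℝ (Fin d))) t₀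
  rw [← hpre]
  exact (hmp.integrableOn_comp_preimage
    (Homeomorph.subRight t₀).measurableEmbedding).2 h0

/-- Admissible exponents can be chosen so close to the optimal ones that they satisfy the strict
inequality. -/
theorem exists_exponents {d : ℕ} {a E δ : ℝ} {P : Params d} {t₀ : EuclideanSpace ℝ (Fin d)}
    (hB : AssumptionB a P E δ t₀) (hC : AssumptionC a P E δ t₀)
    (habc : alphaStar a P E δ t₀ + gammaStar a P E δ t₀ <
      2 * betaStar a P E δ t₀ + (d : EReal)) :
    ∃ α β γ C₃ : ℝ, BoundsB a P E δ t₀ α β ∧ 0 ≤ γ ∧ 0 < C₃ ∧ α + γ < 2 * β + d ∧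
      ∀ᵐ x ∂cubeMeasure d a, C₃ * Phi δ γ (x - t₀) 0 ≤ Delta a P x E := by
  obtain ⟨hδ, ht₀, α₀, β₀, hB₀⟩ := hB
  obtain ⟨γ₀, hC₀⟩ := hC
  have hα : 0 ≤ alphaStar a P E δ t₀ := by
    refine le_sInf ?_
    rintro _ ⟨α, β, h, rfl⟩
    exact_mod_cast h.1
  have hγ : 0 ≤ gammaStar a P E δ t₀ := by
    refine le_sInf ?_
    rintro _ ⟨γ, h, rfl⟩
    exact_mod_cast h.1
  have hα' : alphaStar a P E δ t₀ ≤ α₀ := sInf_le ⟨α₀, β₀, hB₀, rfl⟩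
  have hγ' : gammaStar a P E δ t₀ ≤ γ₀ := sInf_le ⟨γ₀, hC₀, rfl⟩
  have hβ' : (β₀ : EReal) ≤ betaStar a P E δ t₀ := le_sSup ⟨α₀, β₀, hB₀, rfl⟩
  -- As `γ* ≥ 0`, the premise under which Assumption C gives its bound is satisfied.
  have hlt : alphaStar a P E δ t₀ < 2 * betaStar a P E δ t₀ + (d : EReal) :=
    lt_of_le_of_lt (le_add_of_nonneg_right hγ) habc
  lift alphaStar a P E δ t₀ to ℝ using
    ⟨(hα'.trans_lt (EReal.coe_lt_top _)).ne, (EReal.bot_lt_zero.trans_le hα).ne'⟩ with α' eα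
  lift gammaStar a P E δ t₀ to ℝ using
    ⟨(hγ'.trans_lt (EReal.coe_lt_top _)).ne, (EReal.bot_lt_zero.trans_le hγ).ne'⟩ with γ' eγ
  obtain ⟨b, hb, hb'⟩ : ∃ b : ℝ, (b : EReal) < betaStar a P E δ t₀ ∧ α' + γ' < 2 * b + d := by
    induction h : betaStar a P E δ t₀ using EReal.rec with
    | bot => rw [h] at hβ'; simp at hβ'
    | top => exact ⟨α' + γ' + 1, EReal.coe_lt_top _, by
        have h1 : (0 : ℝ) ≤ α' := by exact_mod_cast hα
        have h2 : (0 : ℝ) ≤ γ' := by exact_mod_cast hγ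
        have h3 : (0 : ℝ) ≤ d := d.cast_nonneg
        linarith⟩
    | coe r =>
      rw [h] at habc
      have h0 : ((α' + γ' : ℝ) : EReal) < ((2 * r + d : ℝ) : EReal) := by
        rw [EReal.coe_add, EReal.coe_add, EReal.coe_mul]
        exact habc
      have h1 : α' + γ' < 2 * r + d := EReal.coe_lt_coe_iff.1 h0
      refine ⟨(r + (α' + γ' - d) / 2) / 2, by exact_mod_cast (by linarith), by linarith⟩
  -- The slack left after replacing `β*` by `b` is shared equally between `α` and `γ`.
  have hη : 0 < (2 * b + d - α' - γ') / 2 := by linarith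
  obtain ⟨_, ⟨α, β₁, hαβ, rfl⟩, h1⟩ := sInf_lt_iff.1
    (show alphaStar a P E δ t₀ < ((α' + (2 * b + d - α' - γ') / 2 : ℝ) : EReal) by
      rw [← eα]; exact_mod_cast (by linarith))
  obtain ⟨_, ⟨γ, hγC, rfl⟩, h2⟩ := sInf_lt_iff.1
    (show gammaStar a P E δ t₀ < ((γ' + (2 * b + d - α' - γ') / 2 : ℝ) : EReal) by
      rw [← eγ]; exact_mod_cast (by linarith))
  obtain ⟨_, ⟨α₁, β, hαβ', rfl⟩, h3⟩ := lt_sSup_iff.1 hb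
  have h1 : α < α' + (2 * b + d - α' - γ') / 2 := by exact_mod_cast h1
  have h2 : γ < γ' + (2 * b + d - α' - γ') / 2 := by exact_mod_cast h2
  have h3 : b < β := by exact_mod_cast h3
  obtain ⟨hα0, C₁, _, hC₁, -, hαb⟩ := hαβ
  obtain ⟨-, _, C₂, -, hC₂, hβb⟩ := hαβ'
  obtain ⟨hγ0, C₃, hC₃, hD⟩ := hγC
  -- The bounds on `w₂` and on `v₁` are independent, so `α` from one admissible pair may be combined
  -- with `β` from another.
  refine ⟨α, β, γ, C₃, ⟨hα0, C₁, C₂, hC₁, hC₂, ?_⟩, hγ0, hC₃, by linarith, hD (eα ▸ hlt)⟩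
  filter_upwards [hαb, hβb] with p hp hp'
  exact ⟨hp.1, hp'.2⟩

/-! ### Completing the square in the two-particle component -/

section Form

variable {X : Type*} [MeasurableSpace X] {μ : Measure X}
  {v : X → X → ℂ} {b : X → X → ℝ}

theorem integrable_sq_norm (f : Lp ℂ 2 μ) : Integrable (fun x => ‖f x‖ ^ 2) μ :=
  (memLp_two_iff_integrable_sq_norm (Lp.aestronglyMeasurable f)).1 (Lp.memLp f)

theorem aestronglyMeasurable_sq_div
    (hv : AEStronglyMeasurable (Function.uncurry v) (μ.prod μ))
    (hb : AEStronglyMeasurable (Function.uncurry b) (μ.prod μ)) :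
    AEStronglyMeasurable (fun p : X × X => ‖v p.1 p.2‖ ^ 2 / b p.1 p.2) (μ.prod μ) :=
  (hv.norm.pow 2).div₀ hb

/-- The data entering the completion of the square in the form of the operator matrix: `b` is the
positive function `w₂ - E` and `M` is a bound on `∫ |v(x,y)|² / b(x,y) dy`. -/
structure SquareData (μ : Measure X) (v : X → X → ℂ) (b : X → X → ℝ) (M : ℝ) : Prop where
  v_meas : AEStronglyMeasurable (Function.uncurry v) (μ.prod μ)
  b_meas : AEStronglyMeasurable (Function.uncurry b) (μ.prod μ)
  b_pos : ∀ᵐ p ∂μ.prod μ, 0 < b p.1 p.2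
  b_symm : ∀ᵐ p ∂μ.prod μ, b p.2 p.1 = b p.1 p.2
  integrable : ∀ᵐ x ∂μ, Integrable (fun y => ‖v x y‖ ^ 2 / b x y) μ
  bound : ∀ᵐ x ∂μ, ∫ y, ‖v x y‖ ^ 2 / b x y ∂μ ≤ M

variable {M : ℝ} [SFinite μ]

/-- Integrating in `y` first leaves at most `M |f|²`, which is integrable. All other integrands of
the form are dominated by means of this one. -/
theorem SquareData.integrable_prod (h : SquareData μ v b M) (f : Lp ℂ 2 μ) :
    Integrable (fun p : X × X => ‖v p.1 p.2‖ ^ 2 / b p.1 p.2 * ‖f p.1‖ ^ 2) (μ.prod μ) := by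
  have hm : AEStronglyMeasurable
      (fun p : X × X => ‖v p.1 p.2‖ ^ 2 / b p.1 p.2 * ‖f p.1‖ ^ 2) (μ.prod μ) :=
    (aestronglyMeasurable_sq_div h.v_meas h.b_meas).mul
      ((Lp.aestronglyMeasurable f).comp_fst.norm.pow 2)
  rw [integrable_prod_iff hm]
  refine ⟨?_, ?_⟩
  · filter_upwards [h.integrable] with x hx
    exact hx.mul_const _
  · refine ((integrable_sq_norm f).const_mul M).mono' hm.norm.integral_prod_right' ?_
    filter_upwards [h.bound, Measure.ae_ae_of_ae_prod h.b_pos] with x hx hx'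
    have h1 : ∫ y, ‖‖v x y‖ ^ 2 / b x y * ‖f x‖ ^ 2‖ ∂μ =
        (∫ y, ‖v x y‖ ^ 2 / b x y ∂μ) * ‖f x‖ ^ 2 := by
      rw [← integral_mul_const]
      refine integral_congr_ae ?_
      filter_upwards [hx'] with y hy
      exact Real.norm_of_nonneg (by positivity)
    rw [h1, Real.norm_of_nonneg]
    · gcongr
    · refine mul_nonneg (integral_nonneg_of_ae ?_) (by positivity)
      filter_upwards [hx'] with y hy
      exact div_nonneg (by positivity) hy.le

theorem SquareData.integral_prod (h : SquareData μ v b M) (f : Lp ℂ 2 μ) :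
    ∫ p : X × X, ‖v p.1 p.2‖ ^ 2 / b p.1 p.2 * ‖f p.1‖ ^ 2 ∂μ.prod μ =
      ∫ x, (∫ y, ‖v x y‖ ^ 2 / b x y ∂μ) * ‖f x‖ ^ 2 ∂μ := by
  rw [MeasureTheory.integral_prod _ (h.integrable_prod f)]
  simp_rw [integral_mul_const]

/-- The kernel `v(x,y) conj(v(y,x)) / b(x,y)`. -/
noncomputable def exchangeKernel (v : X → X → ℂ) (b : X → X → ℝ) (p : X × X) : ℂ :=
  v p.1 p.2 * starRingEnd ℂ (v p.2 p.1) / b p.1 p.2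

/-- The right side is `|2bφ + conj A + conj B|² / (4b)` expanded; the mixed term of `A` and `B`
becomes the exchange kernel. -/
theorem square_nonneg {b : ℝ} (hb : 0 < b) (A B φ : ℂ) :
    0 ≤ b * ‖φ‖ ^ 2 + (A * φ).re + (B * φ).re + ‖A‖ ^ 2 / b / 4 + ‖B‖ ^ 2 / b / 4 +
      (A * starRingEnd ℂ B / b).re / 2 := by
  have key : b * ‖φ‖ ^ 2 + (A * φ).re + (B * φ).re + ‖A‖ ^ 2 / b / 4 + ‖B‖ ^ 2 / b / 4 +
      (A * starRingEnd ℂ B / b).re / 2 =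
      ‖2 * b * φ + starRingEnd ℂ A + starRingEnd ℂ B‖ ^ 2 / (4 * b) := by
    rw [Complex.div_ofReal_re]
    simp only [← Complex.normSq_eq_norm_sq, Complex.normSq_apply, Complex.mul_re, Complex.mul_im,
      Complex.add_re, Complex.add_im, Complex.conj_re, Complex.conj_im, Complex.ofReal_re,
      Complex.ofReal_im, Complex.re_ofNat, Complex.im_ofNat]
    field_simp
    ring
  rw [key]
  positivity

/-- Young's inequality with weight `b` splits the product into `b |φ|²` and `|v|² |f|² / b`. -/
theorem SquareData.integrable_mul (h : SquareData μ v b M) (f : Lp ℂ 2 μ)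
    (φ : Lp ℂ 2 (μ.prod μ)) (hφ : Integrable (fun p : X × X => b p.1 p.2 * ‖φ p‖ ^ 2) (μ.prod μ)) :
    Integrable (fun p : X × X => starRingEnd ℂ (f p.1) * v p.1 p.2 * φ p) (μ.prod μ) := by
  have hm : AEStronglyMeasurable
      (fun p : X × X => starRingEnd ℂ (f p.1) * v p.1 p.2 * φ p) (μ.prod μ) :=
    ((RCLike.continuous_conj.comp_aestronglyMeasurable (Lp.aestronglyMeasurable f).comp_fst).mul
      h.v_meas).mul (Lp.aestronglyMeasurable φ)
  refine (hφ.add (h.integrable_prod f)).mono' hm ?_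
  filter_upwards [h.b_pos] with p hp
  simp only [norm_mul, RCLike.norm_conj, Pi.add_apply]
  have h1 : b p.1 p.2 * ‖φ p‖ ^ 2 + ‖v p.1 p.2‖ ^ 2 / b p.1 p.2 * ‖f p.1‖ ^ 2 -
      ‖f p.1‖ * ‖v p.1 p.2‖ * ‖φ p‖ = (b p.1 p.2 * ‖φ p‖ ^ 2 +
        ‖v p.1 p.2‖ ^ 2 / b p.1 p.2 * ‖f p.1‖ ^ 2) / 2 +
      (b p.1 p.2 * ‖φ p‖ - ‖v p.1 p.2‖ * ‖f p.1‖) ^ 2 / (2 * b p.1 p.2) := by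
    field_simp
    ring
  have h2 : 0 ≤ (b p.1 p.2 * ‖φ p‖ ^ 2 +
        ‖v p.1 p.2‖ ^ 2 / b p.1 p.2 * ‖f p.1‖ ^ 2) / 2 +
      (b p.1 p.2 * ‖φ p‖ - ‖v p.1 p.2‖ * ‖f p.1‖) ^ 2 / (2 * b p.1 p.2) := by positivity
  linarith

/-- By the arithmetic-geometric inequality, the diagonal integrand plus its image under the swap is
a majorant; `b` is symmetric. -/
theorem SquareData.integrable_exchange (h : SquareData μ v b M) (f : Lp ℂ 2 μ) :
    Integrable (fun p : X × X => starRingEnd ℂ (f p.1) * f p.2 * exchangeKernel v b p)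
      (μ.prod μ) := by
  have hsw : Measure.QuasiMeasurePreserving (Prod.swap : X × X → X × X) (μ.prod μ) (μ.prod μ) :=
    Measure.measurePreserving_swap.quasiMeasurePreserving
  have hm : AEStronglyMeasurable
      (fun p : X × X => starRingEnd ℂ (f p.1) * f p.2 * exchangeKernel v b p) (μ.prod μ) := by
    refine ((RCLike.continuous_conj.comp_aestronglyMeasurable
      (Lp.aestronglyMeasurable f).comp_fst).mul (Lp.aestronglyMeasurable f).comp_snd).mul ?_
    exact (h.v_meas.mul (RCLike.continuous_conj.comp_aestronglyMeasurable
      (h.v_meas.comp_quasiMeasurePreserving hsw))).div₀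
      (Complex.continuous_ofReal.comp_aestronglyMeasurable h.b_meas)
  have hi := h.integrable_prod f
  refine (hi.add hi.swap).mono' hm ?_
  filter_upwards [h.b_pos, h.b_symm] with p hp hs
  simp only [exchangeKernel, norm_mul, norm_div, RCLike.norm_conj, Pi.add_apply,
    Function.comp_apply, Prod.fst_swap, Prod.snd_swap, Complex.norm_real, hs,
    Real.norm_of_nonneg hp.le]
  have h1 : ‖v p.1 p.2‖ ^ 2 / b p.1 p.2 * ‖f p.1‖ ^ 2 + ‖v p.2 p.1‖ ^ 2 / b p.1 p.2 * ‖f p.2‖ ^ 2 -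
      ‖f p.1‖ * ‖f p.2‖ * (‖v p.1 p.2‖ * ‖v p.2 p.1‖ / b p.1 p.2) =
      ((‖v p.1 p.2‖ * ‖f p.1‖ - ‖v p.2 p.1‖ * ‖f p.2‖) ^ 2 +
        (‖v p.1 p.2‖ * ‖f p.1‖) ^ 2 + (‖v p.2 p.1‖ * ‖f p.2‖) ^ 2) / (2 * b p.1 p.2) := by
    field_simp
    ring
  have h2 : 0 ≤ ((‖v p.1 p.2‖ * ‖f p.1‖ - ‖v p.2 p.1‖ * ‖f p.2‖) ^ 2 +
        (‖v p.1 p.2‖ * ‖f p.1‖) ^ 2 + (‖v p.2 p.1‖ * ‖f p.2‖) ^ 2) / (2 * b p.1 p.2) := by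
    positivity
  linarith

/-- The two-particle part and the coupling of a symmetric state are bounded below by completing the
square. -/
theorem SquareData.form_nonneg (h : SquareData μ v b M) (f : Lp ℂ 2 μ) (φ : symL2 μ)
    (hφ : Integrable (fun p : X × X => b p.1 p.2 * ‖(φ : Lp ℂ 2 (μ.prod μ)) p‖ ^ 2) (μ.prod μ)) :
    0 ≤ (∫ p : X × X, b p.1 p.2 * ‖(φ : Lp ℂ 2 (μ.prod μ)) p‖ ^ 2 ∂μ.prod μ) +
      2 * (∫ p : X × X, starRingEnd ℂ (f p.1) * v p.1 p.2 *
        (φ : Lp ℂ 2 (μ.prod μ)) p ∂μ.prod μ).re +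
      1 / 2 * (∫ x, (∫ y, ‖v x y‖ ^ 2 / b x y ∂μ) * ‖f x‖ ^ 2 ∂μ) +
      1 / 2 * (∫ p : X × X, starRingEnd ℂ (f p.1) * f p.2 * exchangeKernel v b p ∂μ.prod μ).re := by
  set ψ : Lp ℂ 2 (μ.prod μ) := (φ : Lp ℂ 2 (μ.prod μ)) with hψ
  have hsym : ∀ᵐ p ∂μ.prod μ, ψ p.swap = ψ p := φ.2
  let G : X × X → ℂ := fun p => starRingEnd ℂ (f p.1) * v p.1 p.2 * ψ p
  let Q : X × X → ℝ := fun p => ‖v p.1 p.2‖ ^ 2 / b p.1 p.2 * ‖f p.1‖ ^ 2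
  let K : X × X → ℂ := fun p => starRingEnd ℂ (f p.1) * f p.2 * exchangeKernel v b p
  have hG : Integrable G (μ.prod μ) := h.integrable_mul f ψ hφ
  have hQ : Integrable Q (μ.prod μ) := h.integrable_prod f
  have hK : Integrable K (μ.prod μ) := h.integrable_exchange f
  -- Symmetry of `ψ` lets half of the coupling be read at the swapped point. After integration the
  -- two `G` terms give the factor `2` and the two quarters of `Q` give `½`.
  have hpt : ∀ᵐ p ∂μ.prod μ, 0 ≤ b p.1 p.2 * ‖ψ p‖ ^ 2 + (G p).re + (G p.swap).re + Q p / 4 +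
      Q p.swap / 4 + (K p).re / 2 := by
    filter_upwards [h.b_pos, h.b_symm, hsym] with p hp hs hq
    have h1 := square_nonneg hp (starRingEnd ℂ (f p.1) * v p.1 p.2)
      (starRingEnd ℂ (f p.2) * v p.2 p.1) (ψ p)
    simp only [G, Q, K, Prod.fst_swap, Prod.snd_swap, hq, hs, exchangeKernel]
    refine h1.trans_eq ?_
    simp only [norm_mul, RCLike.norm_conj, map_mul, Complex.conj_conj]
    congr 1
    · ring
    · congr 2
      ring
  have h0 := integral_nonneg_of_ae hpt
  have hGr : Integrable (fun p => (G p).re) (μ.prod μ) := hG.re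
  have hGs : Integrable (fun p => (G p.swap).re) (μ.prod μ) := hG.swap.re
  have hKr : Integrable (fun p => (K p).re) (μ.prod μ) := hK.re
  have hQs : Integrable (fun p => Q p.swap) (μ.prod μ) := hQ.swap
  have hre : ∀ {g : X × X → ℂ}, Integrable g (μ.prod μ) →
      ∫ p, (g p).re ∂μ.prod μ = (∫ p, g p ∂μ.prod μ).re := fun hg => integral_re hg
  have i1 : Integrable (fun p => b p.1 p.2 * ‖ψ p‖ ^ 2 + (G p).re) (μ.prod μ) := hφ.add hGr
  have i2 : Integrable (fun p => b p.1 p.2 * ‖ψ p‖ ^ 2 + (G p).re + (G p.swap).re) (μ.prod μ) :=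
    i1.add hGs
  have i3 : Integrable (fun p => b p.1 p.2 * ‖ψ p‖ ^ 2 + (G p).re + (G p.swap).re + Q p / 4)
    (μ.prod μ) := i2.add (hQ.div_const 4)
  have i4 : Integrable (fun p => b p.1 p.2 * ‖ψ p‖ ^ 2 + (G p).re + (G p.swap).re + Q p / 4 +
    Q p.swap / 4) (μ.prod μ) := i3.add (hQs.div_const 4)
  have e1 : ∫ p, (G p.swap).re ∂μ.prod μ = (∫ p, G p ∂μ.prod μ).re :=
    (hre hG.swap).trans (congrArg Complex.re (integral_prod_swap G))
  rw [integral_add i4 (hKr.div_const 2), integral_add i3 (hQs.div_const 4),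
    integral_add i2 (hQ.div_const 4), integral_add i1 hGs, integral_add hφ hGr, integral_div,
    integral_div, integral_div, e1, hre hG, hre hK, integral_prod_swap Q, h.integral_prod f] at h0
  linarith

/-- Finite-dimensional spaces of pairs on which the form of the operator matrix is negative have
bounded dimension, if the exchange kernel weighted by `S` is square-integrable. -/
theorem finrank_le_of_exchangeKernel {S : X → ℝ} (hS : MemLp S ∞ μ)
    (hS0 : ∀ᵐ x ∂μ, S x ≠ 0)
    (hK : MemLp (fun p : X × X => exchangeKernel v b p / (2 * S p.1 * S p.2)) 2 (μ.prod μ))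
    (W : Submodule ℂ (Lp ℂ 2 μ)) [FiniteDimensional ℂ W]
    (hW : ∀ f ∈ W, ∫ x, S x ^ 2 * ‖f x‖ ^ 2 ∂μ ≤
      1 / 2 * (∫ p : X × X, starRingEnd ℂ (f p.1) * f p.2 * exchangeKernel v b p ∂μ.prod μ).re) :
    (Module.finrank ℂ W : ℝ) ≤ ‖hK.toLp‖ ^ 2 := by
  -- Multiplication by `S` preserves dimension, so the Bessel bound may be applied to the functions
  -- `S f` instead of `f`.
  have hinj : Function.Injective (mulOp μ S hS).toLinearMap := by
    rw [← LinearMap.ker_eq_bot, LinearMap.ker_eq_bot']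
    intro f hf
    refine Lp.ext ?_
    have hf' : mulOp μ S hS f = 0 := hf
    have h1 := mulOp_apply μ S hS f
    rw [hf'] at h1
    filter_upwards [h1, Lp.coeFn_zero ℂ 2 μ, hS0] with x h1 h2 h3
    rw [h2] at h1 ⊢
    simpa [h3] using h1.symm
  have hr : Module.finrank ℂ (W.map (mulOp μ S hS).toLinearMap) = Module.finrank ℂ W :=
    (Submodule.equivMapOfInjective _ hinj W).finrank_eq.symm
  rw [← hr]
  refine finrank_le_of_kernel hK _ ?_
  rintro _ ⟨f, hf, rfl⟩
  have hmul := mulOp_apply μ S hS f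
  have h1 : ‖mulOp μ S hS f‖ ^ 2 = ∫ x, S x ^ 2 * ‖f x‖ ^ 2 ∂μ := by
    have h2 : inner ℂ (mulOp μ S hS f) (mulOp μ S hS f) =
        ((∫ x, S x ^ 2 * ‖f x‖ ^ 2 ∂μ : ℝ) : ℂ) := by
      rw [L2.inner_def, ← integral_complex_ofReal]
      refine integral_congr_ae ?_
      filter_upwards [hmul] with x hx
      rw [hx, inner_self_eq_norm_sq_to_K, norm_mul, Complex.norm_real, ← sq_abs (S x),
        ← Real.norm_eq_abs, ← mul_pow]
      push_cast
      rfl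
    rw [inner_self_eq_norm_sq_to_K] at h2
    exact Complex.ofReal_injective (by rw [← h2]; push_cast; rfl)
  have h2 : ∫ p : X × X, starRingEnd ℂ (mulOp μ S hS f p.1) * mulOp μ S hS f p.2 *
      (exchangeKernel v b p / (2 * S p.1 * S p.2)) ∂μ.prod μ =
      1 / 2 * ∫ p : X × X, starRingEnd ℂ (f p.1) * f p.2 * exchangeKernel v b p ∂μ.prod μ := by
    rw [← integral_const_mul]
    refine integral_congr_ae ?_
    filter_upwards [Measure.quasiMeasurePreserving_fst.ae hmul,
      Measure.quasiMeasurePreserving_snd.ae hmul, Measure.quasiMeasurePreserving_fst.ae hS0,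
      Measure.quasiMeasurePreserving_snd.ae hS0] with p h1 h2 h3 h4
    rw [h1, h2]
    simp only [map_mul, Complex.conj_ofReal]
    have h3' : (S p.1 : ℂ) ≠ 0 := Complex.ofReal_ne_zero.2 h3
    have h4' : (S p.2 : ℂ) ≠ 0 := Complex.ofReal_ne_zero.2 h4
    field_simp
  have h3 := hW f hf
  simp only [ContinuousLinearMap.coe_coe]
  rw [h1, h2]
  refine h3.trans_eq ?_
  rw [show (1 / 2 : ℂ) = ((1 / 2 : ℝ) : ℂ) by norm_num, Complex.re_ofReal_mul]

end Form

/-! ### Forms of multiplication operators -/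

section Forms

variable {X : Type*} [MeasurableSpace X] {μ : Measure X} {w : X → ℝ}

theorem inner_mulOp_left (hw : MemLp w ∞ μ) (f g : Lp ℂ 2 μ) :
    inner ℂ (mulOp μ w hw f) g = inner ℂ f (mulOp μ w hw g) := by
  rw [L2.inner_def, L2.inner_def]
  refine integral_congr_ae ?_
  filter_upwards [mulOp_apply μ w hw f, mulOp_apply μ w hw g] with x h1 h2
  rw [h1, h2]
  simp only [RCLike.inner_apply, map_mul, Complex.conj_ofReal]
  ring

theorem inner_mulOp_self (hw : MemLp w ∞ μ) (f : Lp ℂ 2 μ) :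
    inner ℂ f (mulOp μ w hw f) = ((∫ x, w x * ‖f x‖ ^ 2 ∂μ : ℝ) : ℂ) := by
  rw [L2.inner_def, ← integral_complex_ofReal]
  refine integral_congr_ae ?_
  filter_upwards [mulOp_apply μ w hw f] with x h1
  rw [h1, RCLike.inner_apply, mul_assoc, RCLike.mul_conj]
  push_cast
  rfl

theorem norm_sq_eq_integral (f : Lp ℂ 2 μ) : ‖f‖ ^ 2 = ∫ x, ‖f x‖ ^ 2 ∂μ := by
  have h : inner ℂ f f = ((∫ x, ‖f x‖ ^ 2 ∂μ : ℝ) : ℂ) := by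
    rw [L2.inner_def, ← integral_complex_ofReal]
    refine integral_congr_ae (ae_of_all _ fun x => ?_)
    simp only [inner_self_eq_norm_sq_to_K]
    push_cast
    rfl
  rw [inner_self_eq_norm_sq_to_K] at h
  exact Complex.ofReal_injective (by rw [← h]; push_cast; rfl)

theorem integrable_mul_sq_norm (hw : MemLp w ∞ μ) (f : Lp ℂ 2 μ) :
    Integrable (fun x => w x * ‖f x‖ ^ 2) μ :=
  (integrable_sq_norm f).mul_of_top_right hw

theorem integral_kernel_zero [SFinite μ] (K : X × X → ℂ) :
    ∫ p, starRingEnd ℂ ((0 : Lp ℂ 2 μ) p.1) * (0 : Lp ℂ 2 μ) p.2 * K p ∂μ.prod μ = 0 := by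
  have h : ∀ᵐ x ∂μ, (0 : Lp ℂ 2 μ) x = 0 := Lp.coeFn_zero ℂ 2 μ
  refine integral_eq_zero_of_ae ?_
  filter_upwards [Measure.quasiMeasurePreserving_fst.ae h] with p hp
  simp only [hp, map_zero, zero_mul, Pi.zero_apply]

theorem integral_weight_zero (S : X → ℝ) : ∫ x, S x ^ 2 * ‖(0 : Lp ℂ 2 μ) x‖ ^ 2 ∂μ = 0 := by
  refine integral_eq_zero_of_ae ?_
  filter_upwards [Lp.coeFn_zero ℂ 2 μ] with x hx
  rw [hx]
  simp

end Forms

/-! ### The quadratic form of the operator matrix -/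

variable {d : ℕ} {a : ℝ} {P : Params d}

theorem isSymmetric_hamiltonian (hA : AssumptionA a P) :
    LinearMap.IsSymmetric (𝕜 := ℂ) (E := Fock d a) (hamiltonian hA).toLinearMap := by
  intro f g
  have h22 : ∀ φ ψ : H2 d a, inner ℂ (H22 hA φ) ψ = inner ℂ φ (H22 hA ψ) :=
    fun φ ψ => inner_mulOp_left hA.w₂_memLp _ _
  have h11 : ∀ φ ψ : H1 d a, inner ℂ (H11 hA φ) ψ = inner ℂ φ (H11 hA ψ) :=
    fun φ ψ => inner_mulOp_left hA.w₁_memLp _ _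
  have h00 : ∀ u v : ℂ, inner ℂ ((P.w₀ : ℂ) * u) v = inner ℂ u ((P.w₀ : ℂ) * v) := by
    intro u v
    simp only [RCLike.inner_apply, map_mul, Complex.conj_ofReal]
    ring
  simp only [ContinuousLinearMap.coe_coe, hamiltonian_apply, WithLp.prod_inner_apply,
    inner_add_left, inner_add_right, ContinuousLinearMap.adjoint_inner_left,
    ContinuousLinearMap.adjoint_inner_right, h00, h11, h22]
  simp only [WithLp.fst, WithLp.snd]
  ring

/-- With zero vacuum component only the lower `2 × 2` block contributes, and `H12` and its adjoint
give conjugate terms. `SquareData` justifies Fubini for the coupling. -/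
theorem re_inner_hamiltonian (hA : AssumptionA a P) {E M : ℝ}
    (hs : SquareData (cubeMeasure d a) P.v₁ (fun x y => P.w₂ x y - E) M)
    (f : Fock d a) (hf : f.fst = 0) :
    (inner ℂ f (hamiltonian hA f)).re - E * ‖f‖ ^ 2 =
      (∫ x, (P.w₁ x - E) * ‖f.snd.fst x‖ ^ 2 ∂cubeMeasure d a) +
      2 * (∫ p, starRingEnd ℂ (f.snd.fst p.1) * P.v₁ p.1 p.2 *
        (f.snd.snd : Lp ℂ 2 ((cubeMeasure d a).prod (cubeMeasure d a))) p
          ∂(cubeMeasure d a).prod (cubeMeasure d a)).re +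
      ∫ p, (P.w₂ p.1 p.2 - E) *
        ‖(f.snd.snd : Lp ℂ 2 ((cubeMeasure d a).prod (cubeMeasure d a))) p‖ ^ 2
          ∂(cubeMeasure d a).prod (cubeMeasure d a) := by
  set μ := cubeMeasure d a
  set f₁ : Lp ℂ 2 μ := f.snd.fst with hf₁
  set φ : symL2 μ := f.snd.snd with hφ
  set ψ : Lp ℂ 2 (μ.prod μ) := (φ : Lp ℂ 2 (μ.prod μ)) with hψ
  have hw1 := integrable_mul_sq_norm hA.w₁_memLp f₁
  have hw2 : Integrable (fun p => P.w₂ p.1 p.2 * ‖ψ p‖ ^ 2) (μ.prod μ) :=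
    integrable_mul_sq_norm hA.w₂_memLp ψ
  have hb : Integrable (fun p => (P.w₂ p.1 p.2 - E) * ‖ψ p‖ ^ 2) (μ.prod μ) := by
    simp_rw [sub_mul]
    exact hw2.sub ((integrable_sq_norm ψ).const_mul E)
  have h12 : inner ℂ f₁ (H12 hA φ) =
      ∫ p, starRingEnd ℂ (f₁ p.1) * P.v₁ p.1 p.2 * ψ p ∂μ.prod μ := by
    rw [L2.inner_def, MeasureTheory.integral_prod _ (hs.integrable_mul f₁ ψ hb)]
    refine integral_congr_ae ?_
    filter_upwards [partialIntegralOp_apply hA.partialKernel ψ] with x hx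
    have hx' : H12 hA φ x = ∫ s, P.v₁ x s * ψ (x, s) ∂μ := hx
    rw [hx', RCLike.inner_apply, mul_comm, ← integral_const_mul]
    simp_rw [mul_assoc]
  have hn : ‖f‖ ^ 2 = ‖f₁‖ ^ 2 + ‖ψ‖ ^ 2 := by
    rw [WithLp.prod_norm_sq_eq_of_L2, hf, WithLp.prod_norm_sq_eq_of_L2]
    simp [hf₁, hψ, hφ]
  have hq : inner ℂ f (hamiltonian hA f) = ((∫ x, P.w₁ x * ‖f₁ x‖ ^ 2 ∂μ : ℝ) : ℂ) +
      inner ℂ f₁ (H12 hA φ) + inner ℂ (H12 hA φ) f₁ +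
      ((∫ p, P.w₂ p.1 p.2 * ‖ψ p‖ ^ 2 ∂μ.prod μ : ℝ) : ℂ) := by
    have h1 := inner_mulOp_self hA.w₁_memLp f₁
    have h2 : inner ℂ φ (H22 hA φ) = ((∫ p, P.w₂ p.1 p.2 * ‖ψ p‖ ^ 2 ∂μ.prod μ : ℝ) : ℂ) :=
      inner_mulOp_self hA.w₂_memLp ψ
    rw [← h1, ← h2, hamiltonian_apply, WithLp.prod_inner_apply, WithLp.prod_inner_apply]
    simp only [inner_add_right, ContinuousLinearMap.adjoint_inner_right]
    have hf' : f.ofLp.1 = 0 := hf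
    simp only [hf, hf', inner_zero_left, inner_zero_right, zero_add]
    change (inner ℂ f₁ (H11 hA f₁) + inner ℂ f₁ (H12 hA φ)) +
      (inner ℂ (H12 hA φ) f₁ + inner ℂ φ (H22 hA φ)) = _
    simp only [H11]
    ring
  have hre : (inner ℂ (H12 hA φ) f₁).re = (inner ℂ f₁ (H12 hA φ)).re := by
    rw [← inner_conj_symm, Complex.conj_re]
  have e1 : ∫ x, (P.w₁ x - E) * ‖f₁ x‖ ^ 2 ∂μ =
      (∫ x, P.w₁ x * ‖f₁ x‖ ^ 2 ∂μ) - E * ‖f₁‖ ^ 2 := by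
    rw [norm_sq_eq_integral, ← integral_const_mul,
      ← integral_sub hw1 ((integrable_sq_norm f₁).const_mul E)]
    simp_rw [sub_mul]
    rfl
  have e2 : ∫ p, (P.w₂ p.1 p.2 - E) * ‖ψ p‖ ^ 2 ∂μ.prod μ =
      (∫ p, P.w₂ p.1 p.2 * ‖ψ p‖ ^ 2 ∂μ.prod μ) - E * ‖ψ‖ ^ 2 := by
    rw [norm_sq_eq_integral, ← integral_const_mul,
      ← integral_sub hw2 ((integrable_sq_norm ψ).const_mul E)]
    simp_rw [sub_mul]
  rw [hq, hn, e1, e2, Complex.add_re, Complex.add_re, Complex.add_re, hre, h12, Complex.ofReal_re,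
    Complex.ofReal_re]
  ring

theorem integrable_sub_const_mul_sq_norm {X : Type*} [MeasurableSpace X] {μ : Measure X} {w : X → ℝ}
    (hw : MemLp w ∞ μ) (E : ℝ) (f : Lp ℂ 2 μ) : Integrable (fun x => (w x - E) * ‖f x‖ ^ 2) μ := by
  simp_rw [sub_mul]
  exact (integrable_mul_sq_norm hw f).sub ((integrable_sq_norm f).const_mul E)

/-- If the form of `H - E` is negative at a state without vacuum component, then the exchange kernel
dominates the weight `S² ≤ Δ(·;E)` on its one-particle component. -/
theorem integral_lt_of_form_neg (hA : AssumptionA a P) {E M : ℝ}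
    (hs : SquareData (cubeMeasure d a) P.v₁ (fun x y => P.w₂ x y - E) M)
    {S : EuclideanSpace ℝ (Fin d) → ℝ}
    (hSD : ∀ᵐ x ∂cubeMeasure d a, S x ^ 2 ≤ Delta a P x E)
    (F : Fock d a) (hF0 : F.fst = 0)
    (hlt : (inner ℂ F (hamiltonian hA F)).re < E * ‖F‖ ^ 2) :
    ∫ x, S x ^ 2 * ‖F.snd.fst x‖ ^ 2 ∂cubeMeasure d a <
      1 / 2 * (∫ p, starRingEnd ℂ (F.snd.fst p.1) * F.snd.fst p.2 *
        exchangeKernel P.v₁ (fun x y => P.w₂ x y - E) p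
          ∂(cubeMeasure d a).prod (cubeMeasure d a)).re := by
  have hq := re_inner_hamiltonian hA hs F hF0
  have h0 := hs.form_nonneg F.snd.fst F.snd.snd
    (integrable_sub_const_mul_sq_norm hA.w₂_memLp E _)
  set J : EuclideanSpace ℝ (Fin d) → ℝ := fun x =>
    ∫ y, ‖P.v₁ x y‖ ^ 2 / (P.w₂ x y - E) ∂cubeMeasure d a
  have hJi : Integrable (fun x => J x * ‖F.snd.fst x‖ ^ 2) (cubeMeasure d a) := by
    have := (hs.integrable_prod F.snd.fst).integral_prod_left
    simp_rw [integral_mul_const] at this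
    exact this
  have hw1 : Integrable (fun x => (P.w₁ x - E) * ‖F.snd.fst x‖ ^ 2) (cubeMeasure d a) := 
    integrable_sub_const_mul_sq_norm hA.w₁_memLp E _
  have hD : ∫ x, S x ^ 2 * ‖F.snd.fst x‖ ^ 2 ∂cubeMeasure d a ≤
      (∫ x, (P.w₁ x - E) * ‖F.snd.fst x‖ ^ 2 ∂cubeMeasure d a) -
        1 / 2 * ∫ x, J x * ‖F.snd.fst x‖ ^ 2 ∂cubeMeasure d a := by
    rw [← integral_const_mul, ← integral_sub hw1 (hJi.const_mul _)]
    refine integral_mono_of_nonneg (ae_of_all _ fun x => by positivity)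
      (hw1.sub (hJi.const_mul _)) ?_
    -- Here the diagonal term of the completed square joins `w₁ - E` to form `Δ(x;E)`.
    filter_upwards [hSD] with x hx
    have : (P.w₁ x - E) * ‖F.snd.fst x‖ ^ 2 - 1 / 2 * (J x * ‖F.snd.fst x‖ ^ 2) =
        Delta a P x E * ‖F.snd.fst x‖ ^ 2 := by
      simp only [Delta, J]
      ring
    simp only [this]
    gcongr
  linarith

/-- Subspaces on which the form of `H - E` is negative have bounded dimension, if the exchange
kernel weighted by a function `S` with `S² ≤ Δ(·;E)` is square-integrable. -/
theorem exists_finrank_bound (hA : AssumptionA a P) {E M : ℝ}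
    (hs : SquareData (cubeMeasure d a) P.v₁ (fun x y => P.w₂ x y - E) M)
    {S : EuclideanSpace ℝ (Fin d) → ℝ} (hS : MemLp S ∞ (cubeMeasure d a))
    (hS0 : ∀ᵐ x ∂cubeMeasure d a, S x ≠ 0)
    (hSD : ∀ᵐ x ∂cubeMeasure d a, S x ^ 2 ≤ Delta a P x E)
    (hK : MemLp (fun p => exchangeKernel P.v₁ (fun x y => P.w₂ x y - E) p /
      (2 * S p.1 * S p.2)) 2 ((cubeMeasure d a).prod (cubeMeasure d a))) :
    ∃ N : ℕ, ∀ V : Submodule ℂ (Fock d a), FiniteDimensional ℂ V →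
      (∀ f ∈ V, f ≠ 0 → (inner ℂ f (hamiltonian hA f)).re < E * ‖f‖ ^ 2) →
      Module.finrank ℂ V ≤ N := by
  set μ := cubeMeasure d a with hμ
  obtain ⟨N, hN⟩ := exists_nat_ge (‖hK.toLp‖ ^ 2)
  -- The extra `1` pays for restricting to the kernel of the vacuum component.
  refine ⟨N + 1, fun V hV hneg => ?_⟩
  let p₀ : V →ₗ[ℂ] ℂ := (WithLp.fstL 2 ℂ ℂ (WithLp 2 (H1 d a × H2 d a))).toLinearMap ∘ₗ V.subtype
  let p₁ : Fock d a →ₗ[ℂ] H1 d a := ((WithLp.fstL 2 ℂ (H1 d a) (H2 d a)).comp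
    (WithLp.sndL 2 ℂ ℂ (WithLp 2 (H1 d a × H2 d a)))).toLinearMap
  let V₀ := LinearMap.ker p₀
  let L : V₀ →ₗ[ℂ] H1 d a := p₁ ∘ₗ V.subtype ∘ₗ V₀.subtype
  have hrank : Module.finrank ℂ V ≤ Module.finrank ℂ V₀ + 1 := by
    have h1 := LinearMap.finrank_range_add_finrank_ker p₀
    have h2 := Submodule.finrank_le (LinearMap.range p₀)
    rw [Module.finrank_self] at h2
    change Module.finrank ℂ V ≤ Module.finrank ℂ (LinearMap.ker p₀) + 1
    omega
  have hform : ∀ f : V₀, (f : V) ≠ 0 → ∫ x, S x ^ 2 * ‖L f x‖ ^ 2 ∂μ <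
      1 / 2 * (∫ p, starRingEnd ℂ (L f p.1) * L f p.2 *
        exchangeKernel P.v₁ (fun x y => P.w₂ x y - E) p ∂μ.prod μ).re := by
    intro f hf
    have hF0 : ((f : V) : Fock d a).fst = 0 := f.2
    exact integral_lt_of_form_neg hA hs hSD _ hF0 (hneg _ (f : V).2 fun h => hf (Subtype.ext h))
  -- A nonzero state of `V₀` with no one-particle component would make the strict inequality read `0
  -- < 0`.
  have hinj : Function.Injective L := by
    rw [← LinearMap.ker_eq_bot, LinearMap.ker_eq_bot']
    intro f hf
    by_contra hne
    have h1 := hform f (fun h => hne (Subtype.ext h))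
    rw [hf] at h1
    refine lt_irrefl (0 : ℝ) ?_
    calc (0 : ℝ) = ∫ x, S x ^ 2 * ‖(0 : Lp ℂ 2 μ) x‖ ^ 2 ∂μ := (integral_weight_zero S).symm
      _ < _ := h1
      _ = 0 := by rw [integral_kernel_zero]; simp
  have hle := finrank_le_of_exchangeKernel hS hS0 hK (LinearMap.range L) (by
    rintro _ ⟨f, rfl⟩
    by_cases hf : f = 0
    · subst hf
      rw [map_zero, integral_weight_zero, integral_kernel_zero]
      simp
    · exact (hform f fun h => hf (Subtype.ext h)).le)
  rw [LinearMap.finrank_range_of_inj hinj] at hle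
  have : Module.finrank ℂ V₀ ≤ N := by exact_mod_cast hle.trans hN
  omega

/-! ### Power bounds and their consequences -/

theorem Phi_nonneg (δ s : ℝ) (x y : EuclideanSpace ℝ (Fin d)) : 0 ≤ Phi δ s x y := by
  unfold Phi
  split_ifs
  · positivity
  · exact zero_le_one

theorem Phi_of_mem {δ s : ℝ} {x y : EuclideanSpace ℝ (Fin d)} (hx : x ∈ Metric.ball 0 δ)
    (hy : y ∈ Metric.ball 0 δ) : Phi δ s x y = ‖x‖ ^ s + ‖y‖ ^ s :=
  if_pos ⟨hx, hy⟩

theorem Phi_of_not_mem {δ s : ℝ} {x y : EuclideanSpace ℝ (Fin d)}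
    (h : ¬(x ∈ Metric.ball 0 δ ∧ y ∈ Metric.ball 0 δ)) : Phi δ s x y = 1 :=
  if_neg h

/-- The factor `2` is needed only for `s = 0`, where `0 ^ 0 = 1`; otherwise the first summand
vanishes. -/
theorem Phi_zero_left_le {δ s : ℝ} (hδ : 0 < δ) {y : EuclideanSpace ℝ (Fin d)}
    (hy : y ∈ Metric.ball 0 δ) : Phi δ s 0 y ≤ 2 * ‖y‖ ^ s := by
  rw [Phi_of_mem (Metric.mem_ball_self hδ) hy, norm_zero]
  rcases eq_or_ne s 0 with rfl | hs
  · norm_num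
  · rw [Real.zero_rpow hs]
    have : 0 ≤ ‖y‖ ^ s := by positivity
    linarith

theorem sub_mem_ball_zero {δ : ℝ} {x t : EuclideanSpace ℝ (Fin d)} :
    x - t ∈ Metric.ball 0 δ ↔ x ∈ Metric.ball t δ := by
  simp [dist_eq_norm]

theorem ae_ne_cubeMeasure (hd : 0 < d) (t : EuclideanSpace ℝ (Fin d)) :
    ∀ᵐ x ∂cubeMeasure d a, x ≠ t := by
  have : Nonempty (Fin d) := ⟨⟨0, hd⟩⟩
  exact Measure.ae_ne _ t

/-- The power bounds of `BoundsB` for `w₂` and `v₁` in terms of the distances from `t₀`. -/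
structure PowerBounds (a : ℝ) (P : Params d) (E δ : ℝ) (t₀ : EuclideanSpace ℝ (Fin d))
    (α β C₁ C₂ : ℝ) : Prop where
  near : ∀ᵐ p ∂(cubeMeasure d a).prod (cubeMeasure d a), p.1 ∈ Metric.ball t₀ δ →
    p.2 ∈ Metric.ball t₀ δ → C₁ * (‖p.1 - t₀‖ ^ α + ‖p.2 - t₀‖ ^ α) ≤ P.w₂ p.1 p.2 - E
  far : ∀ᵐ p ∂(cubeMeasure d a).prod (cubeMeasure d a),
    ¬(p.1 ∈ Metric.ball t₀ δ ∧ p.2 ∈ Metric.ball t₀ δ) → C₁ ≤ P.w₂ p.1 p.2 - E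
  v₁_le : ∀ᵐ p ∂(cubeMeasure d a).prod (cubeMeasure d a), p.2 ∈ Metric.ball t₀ δ →
    ‖P.v₁ p.1 p.2‖ ≤ C₂ * ‖p.2 - t₀‖ ^ β

theorem BoundsB.exists_powerBounds {E δ α β : ℝ} {t₀ : EuclideanSpace ℝ (Fin d)} (hδ : 0 < δ)
    (h : BoundsB a P E δ t₀ α β) :
    ∃ C₁ C₂ : ℝ, 0 < C₁ ∧ 0 < C₂ ∧ PowerBounds a P E δ t₀ α β C₁ C₂ := by
  obtain ⟨-, C₁, C₂, hC₁, hC₂, h⟩ := h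
  refine ⟨C₁, 2 * C₂, hC₁, by positivity, ⟨?_, ?_, ?_⟩⟩
  · filter_upwards [h] with p hp h1 h2
    rw [Phi_of_mem (sub_mem_ball_zero.2 h1) (sub_mem_ball_zero.2 h2)] at hp
    exact hp.1
  · filter_upwards [h] with p hp h1
    rw [Phi_of_not_mem (by rwa [sub_mem_ball_zero, sub_mem_ball_zero]), mul_one] at hp
    exact hp.1
  · filter_upwards [h] with p hp h1
    have h2 := hp.2
    rw [indicator_of_mem h1, one_mul] at h2
    refine h2.trans ?_
    have := Phi_zero_left_le (s := β) hδ (sub_mem_ball_zero.2 h1)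
    calc _ ≤ C₂ * (2 * ‖p.2 - t₀‖ ^ β) := by gcongr
      _ = _ := by ring

theorem exists_ae_le_of_memLp_top {X : Type*} [MeasurableSpace X] {μ : Measure X} {w : X → ℝ}
    (hw : MemLp w ∞ μ) : ∃ W : ℝ, ∀ᵐ x ∂μ, w x ≤ W := by
  refine ⟨(eLpNormEssSup w μ).toReal, ?_⟩
  have hfin : eLpNormEssSup w μ ≠ ∞ := by
    rw [← eLpNorm_exponent_top]
    exact hw.2.ne
  filter_upwards [ae_le_eLpNormEssSup (f := w) (μ := μ)] with x hx
  have h1 := ENNReal.toReal_mono hfin hx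
  rw [toReal_enorm] at h1
  exact (Real.le_norm_self _).trans h1

/-- For fixed `x ≠ t₀`, `w₂(x,·) - E` is bounded below by a positive constant, so `v₁(x,·) ∈ L²`
gives integrability of the quotient. That constant degenerates as `x → t₀` when `α > 0`; the uniform
bound comes instead from `Δ ≥ 0`, which says that the integral is at most `2 (w₁(x) - E)`. -/
theorem PowerBounds.squareData (hd : 0 < d) (hA : AssumptionA a P) {E δ α β C₁ C₂ : ℝ}
    {t₀ : EuclideanSpace ℝ (Fin d)} (hC₁ : 0 < C₁) (hP : PowerBounds a P E δ t₀ α β C₁ C₂)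
    (hΔ : ∀ᵐ x ∂cubeMeasure d a, 0 ≤ Delta a P x E) :
    ∃ M, SquareData (cubeMeasure d a) P.v₁ (fun x y => P.w₂ x y - E) M := by
  obtain ⟨W, hW⟩ := exists_ae_le_of_memLp_top hA.w₁_memLp
  have hbm : AEStronglyMeasurable (Function.uncurry fun x y => P.w₂ x y - E)
      ((cubeMeasure d a).prod (cubeMeasure d a)) :=
    hA.w₂_memLp.1.sub aestronglyMeasurable_const
  have hlow : ∀ᵐ p ∂(cubeMeasure d a).prod (cubeMeasure d a), p.1 ≠ t₀ →
      C₁ * min 1 (‖p.1 - t₀‖ ^ α) ≤ P.w₂ p.1 p.2 - E := by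
    filter_upwards [hP.near, hP.far] with p h1 h2 h0
    by_cases hp : p.1 ∈ Metric.ball t₀ δ ∧ p.2 ∈ Metric.ball t₀ δ
    · refine le_trans ?_ (h1 hp.1 hp.2)
      gcongr
      refine (min_le_right _ _).trans ?_
      have : 0 ≤ ‖p.2 - t₀‖ ^ α := by positivity
      linarith
    · refine le_trans ?_ (h2 hp)
      exact mul_le_of_le_one_right hC₁.le (min_le_left _ _)
  have hmin : ∀ x : EuclideanSpace ℝ (Fin d), x ≠ t₀ → 0 < C₁ * min 1 (‖x - t₀‖ ^ α) := by
    intro x hx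
    have : 0 < ‖x - t₀‖ := norm_pos_iff.2 (sub_ne_zero.2 hx)
    positivity
  refine ⟨2 * (W - E), hA.v₁_meas, hbm, ?_, ?_, ?_, ?_⟩
  · filter_upwards [hlow, Measure.quasiMeasurePreserving_fst.ae (ae_ne_cubeMeasure hd t₀)]
      with p h1 h2
    exact (hmin _ h2).trans_le (h1 h2)
  · filter_upwards [hA.w₂_ae_symm] with p hp
    rw [hp]
  · filter_upwards [Measure.ae_ae_of_ae_prod hlow, ae_ne_cubeMeasure hd t₀,
      hA.partialKernel.memLp, (aestronglyMeasurable_sq_div hA.v₁_meas hbm).prodMk_left]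
      with x h1 h2 h3 h4
    have h5 := ((memLp_two_iff_integrable_sq_norm h3.1).1 h3).div_const
      (C₁ * min 1 (‖x - t₀‖ ^ α))
    refine h5.mono' h4 ?_
    filter_upwards [h1] with y hy
    have hy' := hy h2
    have h0 := hmin x h2
    rw [Real.norm_of_nonneg (div_nonneg (by positivity) (h0.le.trans hy'))]
    gcongr
  · filter_upwards [hΔ, hW] with x h1 h2
    rw [Delta] at h1
    linarith

/-! ### The Hilbert-Schmidt bound -/

theorem near_kernel_le {r r' α β γ b C₁ C₂ N N' : ℝ} (hr : 0 < r) (hr' : 0 < r') (hC₁ : 0 < C₁)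
    (hN : 0 ≤ N) (hN' : 0 ≤ N')
    (hb : C₁ * (r ^ α + r' ^ α) ≤ b) (h : N ≤ C₂ * r' ^ β) (h' : N' ≤ C₂ * r ^ β) :
    N ^ 2 * N' ^ 2 / (b ^ 2 * (r ^ γ * r' ^ γ)) ≤
      C₂ ^ 4 / C₁ ^ 2 * (r ^ (2 * β - α - γ) * r' ^ (2 * β - α - γ)) := by
  have hpow : ∀ {t : ℝ}, 0 < t → t ^ (2 * β - α - γ) * (t ^ α * t ^ γ) = (t ^ β) ^ 2 := by
    intro t ht
    rw [← Real.rpow_add ht, ← Real.rpow_add ht, ← Real.rpow_natCast, ← Real.rpow_mul ht.le]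
    congr 1
    push_cast
    ring
  have ha := Real.rpow_pos_of_pos hr α
  have ha' := Real.rpow_pos_of_pos hr' α
  have hb0 : 0 < b := lt_of_lt_of_le (by positivity) hb
  -- The square of the sum dominates the product, so the singularity factorizes and each variable
  -- carries one `α`.
  have hb2 : C₁ ^ 2 * (r ^ α * r' ^ α) ≤ b ^ 2 := by
    calc C₁ ^ 2 * (r ^ α * r' ^ α) ≤ (C₁ * (r ^ α + r' ^ α)) ^ 2 := by
          rw [mul_pow]
          gcongr
          nlinarith
      _ ≤ b ^ 2 := by gcongr
  rw [div_le_iff₀ (by positivity)]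
  calc N ^ 2 * N' ^ 2 ≤ (C₂ * r' ^ β) ^ 2 * (C₂ * r ^ β) ^ 2 := by gcongr
    _ = C₂ ^ 4 / C₁ ^ 2 * (C₁ ^ 2 * ((r ^ β) ^ 2 * (r' ^ β) ^ 2)) := by
        field_simp
    _ = C₂ ^ 4 / C₁ ^ 2 * (r ^ (2 * β - α - γ) * r' ^ (2 * β - α - γ)) *
        (C₁ ^ 2 * (r ^ α * r' ^ α) * (r ^ γ * r' ^ γ)) := by
        rw [← hpow hr, ← hpow hr']
        ring
    _ ≤ _ := by gcongr

/-- Case of exactly one point near `t₀`: only one of the two kernel values has a power bound, and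
the other, `N`, is kept for its `L²` bound. -/
theorem far_kernel_le {r β γ b C₁ C₂ N N' : ℝ} (hr : 0 < r) (hC₁ : 0 < C₁) (hN' : 0 ≤ N')
    (hb : C₁ ≤ b) (h' : N' ≤ C₂ * r ^ β) :
    N ^ 2 * N' ^ 2 / (b ^ 2 * r ^ γ) ≤ C₂ ^ 2 / C₁ ^ 2 * (N ^ 2 * r ^ (2 * β - γ)) := by
  have hpow : r ^ (2 * β - γ) * r ^ γ = (r ^ β) ^ 2 := by
    rw [← Real.rpow_add hr, ← Real.rpow_natCast, ← Real.rpow_mul hr.le]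
    congr 1
    push_cast
    ring
  have hg := Real.rpow_pos_of_pos hr γ
  have hb0 : 0 < b := hC₁.trans_le hb
  rw [div_le_iff₀ (by positivity)]
  calc N ^ 2 * N' ^ 2 ≤ N ^ 2 * (C₂ * r ^ β) ^ 2 := by gcongr
    _ = C₂ ^ 2 / C₁ ^ 2 * (N ^ 2 * (r ^ β) ^ 2) * C₁ ^ 2 := by
        field_simp
    _ = C₂ ^ 2 / C₁ ^ 2 * (N ^ 2 * r ^ (2 * β - γ)) * (C₁ ^ 2 * r ^ γ) := by
        rw [← hpow]
        ring
    _ ≤ _ := by gcongr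

theorem PartialKernel.integrable_sq_mul {X : Type*} [MeasurableSpace X] {μ : Measure X} [SFinite μ]
    {v : X → X → ℂ} (hv : PartialKernel μ v) {k : X → ℝ} (hk : Integrable k μ) :
    Integrable (fun p : X × X => ‖v p.1 p.2‖ ^ 2 * k p.1) (μ.prod μ) := by
  have hm : AEStronglyMeasurable (fun p : X × X => ‖v p.1 p.2‖ ^ 2 * k p.1) (μ.prod μ) :=
    (hv.meas.norm.pow 2).mul hk.1.comp_fst
  refine ⟨hm, ?_⟩
  rw [HasFiniteIntegral, lintegral_prod _ hm.enorm]
  set C := essSup (fun x => eLpNorm (v x) 2 μ) μ with hC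
  calc ∫⁻ x, ∫⁻ y, ‖‖v x y‖ ^ 2 * k x‖ₑ ∂μ ∂μ ≤ ∫⁻ x, C ^ (2 : ℝ) * ‖k x‖ₑ ∂μ := by
        refine lintegral_mono_ae ?_
        filter_upwards [ae_le_essSup (μ := μ) (f := fun x => eLpNorm (v x) 2 μ)] with x hx
        simp_rw [enorm_mul]
        rw [lintegral_mul_const' _ _ enorm_ne_top]
        gcongr
        refine le_trans (le_of_eq ?_) (ENNReal.rpow_le_rpow hx (by norm_num))
        rw [eLpNorm_two_rpow]
        simp
    _ = C ^ (2 : ℝ) * ∫⁻ x, ‖k x‖ₑ ∂μ :=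
        lintegral_const_mul' _ _ (ENNReal.rpow_ne_top_of_nonneg (by norm_num) hv.bound.ne)
    _ < ∞ := ENNReal.mul_lt_top (ENNReal.rpow_lt_top_of_nonneg (by norm_num) hv.bound.ne) hk.2

/-- The exponents of Assumption A are matched: `1/(2+ε) + 1/(2+4/ε) = 1/2`. Hölder therefore bounds
the `L²` norm of `y ↦ v₁(x,y) v₁(y,x)` uniformly in `x`, and `Ω` has finite measure. -/
theorem AssumptionA.integrable_sq_mul_sq (hA : AssumptionA a P) :
    Integrable (fun p => ‖P.v₁ p.1 p.2‖ ^ 2 * ‖P.v₁ p.2 p.1‖ ^ 2)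
      ((cubeMeasure d a).prod (cubeMeasure d a)) := by
  obtain ⟨ε, hε, h1, h2⟩ := hA.v₁_bound
  set μ := cubeMeasure d a
  set C := essSup (fun x => eLpNorm (fun y => P.v₁ x y) (ENNReal.ofReal (2 + ε)) μ) μ
  set C' := essSup (fun y => eLpNorm (fun x => P.v₁ x y) (ENNReal.ofReal (2 + 4 / ε)) μ) μ
  have hpq : (ENNReal.ofReal (2 + ε)).HolderTriple (ENNReal.ofReal (2 + 4 / ε)) 2 := by
    refine ⟨?_⟩
    rw [← ENNReal.ofReal_inv_of_pos (by positivity), ← ENNReal.ofReal_inv_of_pos (by positivity),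
      ← ENNReal.ofReal_add (by positivity) (by positivity),
      show (2 : ℝ≥0∞) = ENNReal.ofReal 2 by simp,
      ← ENNReal.ofReal_inv_of_pos (by positivity)]
    congr 1
    field_simp
    ring
  have hsw : Measure.QuasiMeasurePreserving
      (Prod.swap : EuclideanSpace ℝ (Fin d) × EuclideanSpace ℝ (Fin d) → _)
      (μ.prod μ) (μ.prod μ) := Measure.measurePreserving_swap.quasiMeasurePreserving
  have hv' : AEStronglyMeasurable (fun p : EuclideanSpace ℝ (Fin d) × EuclideanSpace ℝ (Fin d) =>
      P.v₁ p.2 p.1) (μ.prod μ) := hA.v₁_meas.comp_quasiMeasurePreserving hsw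
  have hm : AEStronglyMeasurable (fun p : EuclideanSpace ℝ (Fin d) × EuclideanSpace ℝ (Fin d) =>
      ‖P.v₁ p.1 p.2‖ ^ 2 * ‖P.v₁ p.2 p.1‖ ^ 2) (μ.prod μ) :=
    (hA.v₁_meas.norm.pow 2).mul (hv'.norm.pow 2)
  refine ⟨hm, ?_⟩
  rw [HasFiniteIntegral, lintegral_prod _ hm.enorm]
  calc ∫⁻ x, ∫⁻ y, ‖‖P.v₁ x y‖ ^ 2 * ‖P.v₁ y x‖ ^ 2‖ₑ ∂μ ∂μ ≤
      ∫⁻ _, (C * C') ^ (2 : ℝ) ∂μ := by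
        refine lintegral_mono_ae ?_
        filter_upwards [ae_le_essSup (μ := μ)
            (f := fun x => eLpNorm (fun y => P.v₁ x y) (ENNReal.ofReal (2 + ε)) μ),
          ae_le_essSup (μ := μ)
            (f := fun y => eLpNorm (fun x => P.v₁ x y) (ENNReal.ofReal (2 + 4 / ε)) μ),
          hA.v₁_meas.prodMk_left, hv'.prodMk_left] with x hx hx' hmx hmx'
        have h3 : eLpNorm ((fun y => P.v₁ x y) • fun y => P.v₁ y x) 2 μ ≤ C * C' :=
          (eLpNorm_smul_le_mul_eLpNorm hmx' hmx).trans (mul_le_mul' hx hx')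
        refine le_trans (le_of_eq ?_) (ENNReal.rpow_le_rpow h3 (by norm_num))
        rw [eLpNorm_two_rpow]
        refine lintegral_congr fun y => ?_
        simp [mul_pow]
    _ < ∞ := by
        rw [lintegral_const]
        exact ENNReal.mul_lt_top (ENNReal.rpow_lt_top_of_nonneg (by norm_num)
          (ENNReal.mul_ne_top h1.ne h2.ne)) (measure_lt_top _ _)

theorem integrable_indicator_rpow (hd : 0 < d) {s : ℝ} (hs : -(d : ℝ) < s) (δ : ℝ)
    (t₀ : EuclideanSpace ℝ (Fin d)) :
    Integrable ((Metric.ball t₀ δ).indicator fun x => ‖x - t₀‖ ^ s) (cubeMeasure d a) :=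
  ((integrableOn_norm_sub_rpow hd hs δ t₀).integrable_indicator
    Metric.isOpen_ball.measurableSet).restrict

/-- The weight `√C₃ ‖x - t₀‖ ^ (γ / 2)` near `t₀`, and `√C₃` elsewhere. -/
noncomputable def powerWeight (C₃ γ δ : ℝ) (t₀ x : EuclideanSpace ℝ (Fin d)) : ℝ :=
  open scoped Classical in
  √C₃ * if x ∈ Metric.ball t₀ δ then ‖x - t₀‖ ^ (γ / 2) else 1

theorem powerWeight_sq_of_mem {C₃ γ δ : ℝ} (hC₃ : 0 < C₃) {t₀ x : EuclideanSpace ℝ (Fin d)}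
    (hx : x ∈ Metric.ball t₀ δ) : powerWeight C₃ γ δ t₀ x ^ 2 = C₃ * ‖x - t₀‖ ^ γ := by
  rw [powerWeight, if_pos hx, mul_pow, Real.sq_sqrt hC₃.le, ← Real.rpow_natCast,
    ← Real.rpow_mul (norm_nonneg _)]
  congr 2
  push_cast
  ring

theorem powerWeight_sq_of_not_mem {C₃ γ δ : ℝ} (hC₃ : 0 < C₃) {t₀ x : EuclideanSpace ℝ (Fin d)}
    (hx : x ∉ Metric.ball t₀ δ) : powerWeight C₃ γ δ t₀ x ^ 2 = C₃ := by
  rw [powerWeight, if_neg hx, mul_one, Real.sq_sqrt hC₃.le]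

theorem powerWeight_ne_zero {C₃ γ δ : ℝ} (hC₃ : 0 < C₃) {t₀ x : EuclideanSpace ℝ (Fin d)}
    (hx : x ≠ t₀) : powerWeight C₃ γ δ t₀ x ≠ 0 := by
  have h1 : 0 < ‖x - t₀‖ := norm_pos_iff.2 (sub_ne_zero.2 hx)
  have h2 := Real.sqrt_pos.2 hC₃
  rw [powerWeight]
  split_ifs <;> positivity

theorem powerWeight_sq_le {C₃ γ δ : ℝ} (hC₃ : 0 < C₃) (t₀ x : EuclideanSpace ℝ (Fin d)) :
    powerWeight C₃ γ δ t₀ x ^ 2 ≤ C₃ * Phi δ γ (x - t₀) 0 := by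
  by_cases hx : x ∈ Metric.ball t₀ δ
  · rw [powerWeight_sq_of_mem hC₃ hx, Phi_of_mem (sub_mem_ball_zero.2 hx)
      (Metric.mem_ball_self (Metric.pos_of_mem_ball hx))]
    gcongr
    have : 0 ≤ ‖(0 : EuclideanSpace ℝ (Fin d))‖ ^ γ := by positivity
    linarith
  · rw [powerWeight_sq_of_not_mem hC₃ hx, Phi_of_not_mem (fun h => hx (sub_mem_ball_zero.1 h.1)),
      mul_one]

theorem measurable_powerWeight (C₃ γ δ : ℝ) (t₀ : EuclideanSpace ℝ (Fin d)) :
    Measurable (powerWeight C₃ γ δ t₀) := by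
  unfold powerWeight
  refine measurable_const.mul (Measurable.ite Metric.isOpen_ball.measurableSet ?_ measurable_const)
  fun_prop

theorem memLp_powerWeight {C₃ γ δ : ℝ} (hγ : 0 ≤ γ) (t₀ : EuclideanSpace ℝ (Fin d)) :
    MemLp (powerWeight C₃ γ δ t₀) ∞ (cubeMeasure d a) := by
  -- The sum covers both branches of the weight; `|δ|` avoids a sign condition on `δ`.
  refine memLp_top_of_bound (measurable_powerWeight C₃ γ δ t₀).aestronglyMeasurable
    (√C₃ * (|δ| ^ (γ / 2) + 1)) (ae_of_all _ fun x => ?_)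
  rw [powerWeight, norm_mul, Real.norm_of_nonneg (Real.sqrt_nonneg _)]
  have h0 : 0 ≤ |δ| ^ (γ / 2) := by positivity
  gcongr
  split_ifs with hx
  · rw [Real.norm_of_nonneg (by positivity)]
    have h1 : ‖x - t₀‖ ≤ |δ| := (mem_ball_iff_norm.1 hx).le.trans (le_abs_self δ)
    have h2 : ‖x - t₀‖ ^ (γ / 2) ≤ |δ| ^ (γ / 2) := by gcongr
    linarith
  · rw [norm_one]
    linarith

theorem memLp_weighted_exchangeKernel (hd : 0 < d) (hA : AssumptionA a P)
    {E δ α β γ C₁ C₂ C₃ M : ℝ} {t₀ : EuclideanSpace ℝ (Fin d)} (hC₁ : 0 < C₁) (hC₃ : 0 < C₃)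
    (hα : 0 ≤ α) (habc : α + γ < 2 * β + d)
    (hP : PowerBounds a P E δ t₀ α β C₁ C₂)
    (hs : SquareData (cubeMeasure d a) P.v₁ (fun x y => P.w₂ x y - E) M) :
    MemLp (fun p => exchangeKernel P.v₁ (fun x y => P.w₂ x y - E) p /
      (2 * powerWeight C₃ γ δ t₀ p.1 * powerWeight C₃ γ δ t₀ p.2)) 2
      ((cubeMeasure d a).prod (cubeMeasure d a)) := by
  set μ := cubeMeasure d a
  set S := powerWeight C₃ γ δ t₀ with hS
  set B := Metric.ball t₀ δ with hB
  have hsw : Measure.QuasiMeasurePreserving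
      (Prod.swap : EuclideanSpace ℝ (Fin d) × EuclideanSpace ℝ (Fin d) → _)
      (μ.prod μ) (μ.prod μ) := Measure.measurePreserving_swap.quasiMeasurePreserving
  have hm : AEStronglyMeasurable (fun p => exchangeKernel P.v₁ (fun x y => P.w₂ x y - E) p /
      (2 * S p.1 * S p.2)) (μ.prod μ) := by
    have hSm : Measurable S := measurable_powerWeight C₃ γ δ t₀
    refine AEStronglyMeasurable.div₀ ?_ (Measurable.aestronglyMeasurable (by fun_prop))
    exact (hs.v_meas.mul (RCLike.continuous_conj.comp_aestronglyMeasurable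
      (hs.v_meas.comp_quasiMeasurePreserving hsw))).div₀
      (Complex.continuous_ofReal.comp_aestronglyMeasurable hs.b_meas)
  rw [memLp_two_iff_integrable_sq_norm hm]
  let h : EuclideanSpace ℝ (Fin d) → ℝ := B.indicator fun x => ‖x - t₀‖ ^ (2 * β - α - γ)
  let k : EuclideanSpace ℝ (Fin d) → ℝ := B.indicator fun x => ‖x - t₀‖ ^ (2 * β - γ)
  -- The exponent of `h` exceeds `-d` by `α + γ < 2β + d`; that of `k` is larger still because `α ≥
  -- 0`.
  have hh : Integrable h μ := integrable_indicator_rpow hd (by linarith) δ t₀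
  have hk : Integrable k μ := integrable_indicator_rpow hd (by linarith) δ t₀
  have hk0 : ∀ x, 0 ≤ k x := fun x => indicator_nonneg (fun _ _ => by positivity) x
  have hh0 : ∀ x, 0 ≤ h x := fun x => indicator_nonneg (fun _ _ => by positivity) x
  have hvk : Integrable (fun p : EuclideanSpace ℝ (Fin d) × EuclideanSpace ℝ (Fin d) =>
    ‖P.v₁ p.1 p.2‖ ^ 2 * k p.1) (μ.prod μ) := hA.partialKernel.integrable_sq_mul hk
  have hvk' : Integrable (fun p : EuclideanSpace ℝ (Fin d) × EuclideanSpace ℝ (Fin d) =>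
    ‖P.v₁ p.2 p.1‖ ^ 2 * k p.2) (μ.prod μ) := hvk.swap
  -- One summand for each region: both points near `t₀`, only the first, only the second, neither.
  -- The factor `1 / (4 C₃²)` comes from the `2` in the kernel and the factor `C₃` in each `S²`.
  have hmaj := ((((hh.mul_prod hh).const_mul (C₂ ^ 4 / C₁ ^ 2)).add
    (hvk.const_mul (C₂ ^ 2 / C₁ ^ 2))).add ((hvk'.const_mul (C₂ ^ 2 / C₁ ^ 2)).add
    (hA.integrable_sq_mul_sq.const_mul (1 / C₁ ^ 2)))).const_mul (1 / (4 * C₃ ^ 2))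
  refine hmaj.mono' (hm.norm.pow 2) ?_
  have hne := ae_ne_cubeMeasure (a := a) hd t₀
  filter_upwards [hP.near, hP.far, hP.v₁_le, hsw.ae hP.v₁_le,
    Measure.quasiMeasurePreserving_fst.ae hne, Measure.quasiMeasurePreserving_snd.ae hne]
    with p hnear hfar hv hv' hp1 hp2
  have hr : 0 < ‖p.1 - t₀‖ := norm_pos_iff.2 (sub_ne_zero.2 hp1)
  have hr' : 0 < ‖p.2 - t₀‖ := norm_pos_iff.2 (sub_ne_zero.2 hp2)
  simp only [Prod.fst_swap, Prod.snd_swap] at hv'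
  have hval : ‖‖exchangeKernel P.v₁ (fun x y => P.w₂ x y - E) p / (2 * S p.1 * S p.2)‖ ^ 2‖ =
      1 / (4 * C₃ ^ 2) * (‖P.v₁ p.1 p.2‖ ^ 2 * ‖P.v₁ p.2 p.1‖ ^ 2 /
        ((P.w₂ p.1 p.2 - E) ^ 2 * (S p.1 ^ 2 / C₃ * (S p.2 ^ 2 / C₃)))) := by
    rw [Real.norm_of_nonneg (by positivity)]
    simp only [exchangeKernel, norm_div, norm_mul, RCLike.norm_conj, Complex.norm_real, div_pow,
      mul_pow, Real.norm_eq_abs, sq_abs, Complex.norm_ofNat]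
    field_simp
    norm_num
  rw [hval]
  simp only [Pi.add_apply]
  refine mul_le_mul_of_nonneg_left ?_ (by positivity)
  have p1 := mul_nonneg (by positivity : 0 ≤ C₂ ^ 4 / C₁ ^ 2) (mul_nonneg (hh0 p.1) (hh0 p.2))
  have p2 := mul_nonneg (by positivity : 0 ≤ C₂ ^ 2 / C₁ ^ 2)
    (mul_nonneg (sq_nonneg ‖P.v₁ p.1 p.2‖) (hk0 p.1))
  have p3 := mul_nonneg (by positivity : 0 ≤ C₂ ^ 2 / C₁ ^ 2)
    (mul_nonneg (sq_nonneg ‖P.v₁ p.2 p.1‖) (hk0 p.2))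
  have p4 : 0 ≤ 1 / C₁ ^ 2 * (‖P.v₁ p.1 p.2‖ ^ 2 * ‖P.v₁ p.2 p.1‖ ^ 2) := by positivity
  have hSin : ∀ {x}, x ∈ B → S x ^ 2 / C₃ = ‖x - t₀‖ ^ γ := fun hx => by
    rw [hS, powerWeight_sq_of_mem hC₃ hx, mul_div_cancel_left₀ _ hC₃.ne']
  have hSout : ∀ {x}, x ∉ B → S x ^ 2 / C₃ = 1 := fun hx => by
    rw [hS, powerWeight_sq_of_not_mem hC₃ hx, div_self hC₃.ne']
  have hhin : ∀ {x}, x ∈ B → h x = ‖x - t₀‖ ^ (2 * β - α - γ) := fun hx => indicator_of_mem hx _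
  have hkin : ∀ {x}, x ∈ B → k x = ‖x - t₀‖ ^ (2 * β - γ) := fun hx => indicator_of_mem hx _
  by_cases h1 : p.1 ∈ B <;> by_cases h2 : p.2 ∈ B
  · have := near_kernel_le (γ := γ) hr hr' hC₁ (norm_nonneg _) (norm_nonneg _) (hnear h1 h2)
      (hv h2) (hv' h1)
    rw [hSin h1, hSin h2]
    rw [← hhin h1, ← hhin h2] at this
    linarith
  · have := far_kernel_le (γ := γ) (N := ‖P.v₁ p.1 p.2‖) hr hC₁ (norm_nonneg _)
      (hfar fun h => h2 h.2) (hv' h1)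
    rw [hSin h1, hSout h2, mul_one]
    rw [← hkin h1] at this
    linarith
  · have := far_kernel_le (γ := γ) (N := ‖P.v₁ p.2 p.1‖) hr' hC₁ (norm_nonneg _)
      (hfar fun h => h1 h.1) (hv h2)
    rw [hSout h1, hSin h2, one_mul, mul_comm (‖P.v₁ p.1 p.2‖ ^ 2)]
    rw [← hkin h2] at this
    linarith
  · have hb := hfar fun h => h1 h.1
    have : ‖P.v₁ p.1 p.2‖ ^ 2 * ‖P.v₁ p.2 p.1‖ ^ 2 / (P.w₂ p.1 p.2 - E) ^ 2 ≤
        1 / C₁ ^ 2 * (‖P.v₁ p.1 p.2‖ ^ 2 * ‖P.v₁ p.2 p.1‖ ^ 2) := by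
      rw [div_eq_mul_one_div, mul_comm]
      gcongr
    rw [hSout h1, hSout h2, one_mul, mul_one]
    linarith

end TruncatedFock

theorem theorem5p1 (d : ℕ) (hd : 0 < d) (a : ℝ) (ha : 0 < a)
    (P : TruncatedFock.Params d) (hA : TruncatedFock.AssumptionA a P)
    (Emin : ℝ)
    (hE : IsLeast (TruncatedFock.essentialSpectrum (E := TruncatedFock.Fock d a)
      (TruncatedFock.hamiltonian hA)) Emin)
    (δ : ℝ) (t₀ : EuclideanSpace ℝ (Fin d))
    (hB : TruncatedFock.AssumptionB a P Emin δ t₀)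
    (hC : TruncatedFock.AssumptionC a P Emin δ t₀)
    (habc : TruncatedFock.alphaStar a P Emin δ t₀ + TruncatedFock.gammaStar a P Emin δ t₀ <
      2 * TruncatedFock.betaStar a P Emin δ t₀ + (d : EReal)) :
    {z : ℝ | z < Emin ∧ Module.End.HasEigenvalue
        (TruncatedFock.hamiltonian hA).toLinearMap (z : ℂ)}.Finite ∧
      ∀ z : ℝ, z < Emin → FiniteDimensional ℂ (Module.End.eigenspace
        (TruncatedFock.hamiltonian hA).toLinearMap (z : ℂ)) := by
  obtain ⟨α, β, γ, C₃, hαβ, hγ, hC₃, hlt, hD⟩ := TruncatedFock.exists_exponents hB hC habc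
  obtain ⟨C₁, C₂, hC₁, -, hP⟩ := hαβ.exists_powerBounds hB.1.1
  -- At this point only `Δ ≥ 0` is needed; the full power bound on `Δ` enters through the weight
  -- below.
  obtain ⟨M, hs⟩ := hP.squareData hd hA hC₁ (by
    filter_upwards [hD] with x hx
    exact (mul_nonneg hC₃.le (TruncatedFock.Phi_nonneg _ _ _ _)).trans hx)
  obtain ⟨N, hN⟩ := TruncatedFock.exists_finrank_bound hA hs
    (TruncatedFock.memLp_powerWeight (C₃ := C₃) (δ := δ) hγ t₀)
    (by
      filter_upwards [TruncatedFock.ae_ne_cubeMeasure hd t₀] with x hx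
      exact TruncatedFock.powerWeight_ne_zero hC₃ hx)
    (by
      filter_upwards [hD] with x hx
      exact (TruncatedFock.powerWeight_sq_le hC₃ t₀ x).trans hx)
    (TruncatedFock.memLp_weighted_exchangeKernel hd hA hC₁ hC₃ hαβ.1 hlt hP hs)
  exact ⟨TruncatedFock.finite_eigenvalues_of_form (TruncatedFock.isSymmetric_hamiltonian hA) hN,
    fun z hz => TruncatedFock.finiteDimensional_eigenspace_of_form
      (F := TruncatedFock.Fock d a) hN hz⟩
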